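/- Let $G$ be a finite group and $R$ a commutative unital ring. **Mackey functors.** Let $\Omega_R(G)$ be the $R$-linear category whose objects are the finite $G$-sets and whose morphisms $X\to Y$ form the $R$-module obtained by extension of scalars from the commutative monoid (under disjoint union) of isomorphism classes of spans $X\leftarrow V\to Y$ of finite $G$-sets; composition is given by pullback. For a $G$-map $f:X\to Y$ put $r_f=(X=X\xrightarrow{f}Y)$ and $t_f=(Y\xleftarrow{f}X=X)$. A Mackey functor is an $R$-linear functor $M:\Omega_R(G)^{op}\to R\text{-mod}$; morphisms are natural transformations. The Mackey algebra is $\mu_R(G)=\bigoplus_{H,K\le G}\hom_{\Omega_R(G)}(G/H,G/K)$ with multiplication given by composition ($ab$ is first $a$, then $b$; it is zero where $a$, $b$ are not composable). For $K\le H\le G$ and $g\in G$ let $R^H_K=r_{\pi}$ and $I^H_K=t_{\pi}$, where $\pi:G/K\to G/H$ is the projection, and $C_{g,H}=t_{c}$, where $c:G/H\to G/{}^gH$, $kH\mapsto kg^{-1}\,{}^gH$, and ${}^gH=gHg^{-1}$, $H^g=g^{-1}Hg$. These elements generate $\mu_R(G)$. For a Mackey functor $M$ let $\Phi M=\bigoplus_{H\le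 G}M(G/H)$, a left $\mu_R(G)$-module, so that $I^H_H\Phi M=M(G/H)$. **Dress pairings.** A Dress pairing $\theta$ from $M$ and $N$ to $P$ is a family of $R$-linear maps $\theta_X:M(X)\otimes_R N(X)\to P(X)$, one for each finite $G$-set $X$, such that for every $G$-map $f:X\to Y$ $$r_f\theta_Y(m\otimes n)=\theta_X(r_fm\otimes r_fn),\quad t_f\theta_X(m\otimes r_fn)=\theta_Y(t_fm\otimes n),\quad t_f\theta_X(r_fm\otimes n)=\theta_Y(m\otimes t_fn).$$ The set of these is denoted $\mathrm{Dress}(M,N;P)$. **Box product.** Let $M,N$ be left $\mu_R(G)$-modules. Define inductively $A_H=(I^H_HM\otimes_R I^H_HN)\oplus\bigoplus_{K<H}A_K$ for $H\le G$, and $A=\bigoplus_{H\le G}A_H$. Define operators $I^L_H$, $C_{g,H}$, $R^H_J$ on $A$ that map the grade $A_H$ to $A_L$, $A_{{}^gH}$, $A_J$ respectively and vanish on the other grades: $I^H_H$ is the identity of $A_H$, and for $H<L$ the operator $I^L_H$ is the inclusion of the summand $A_H$ of $A_L$; for $m\otimes n$ in the first summand of $A_H$ and $x\in A_K$, $K<H$,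 $$C_{g,H}(m\otimes n)=C_{g,H}m\otimes C_{g,H}n,\qquad C_{g,H}I^H_Kx=I^{{}^gH}_{{}^gK}C_{g,K}x,$$ $$R^H_J(m\otimes n)=R^H_Jm\otimes R^H_Jn,\qquad R^H_JI^H_Kx=\sum_{g\in[J\backslash H/K]}I^J_{{}^gK\cap J}C_gR^K_{K\cap J^g}x,$$ where $[J\backslash H/K]$ is a fixed set of representatives of the double cosets. Let $FR\subseteq A$ be the smallest $R$-submodule that is stable under all these operators and contains $a\otimes I^H_Kb-I^H_K(R^H_Ka\otimes b)$ and $I^H_Kc\otimes d-I^H_K(c\otimes R^H_Kd)$ for all $K<H$, $a\in I^H_HM$, $b\in I^K_KN$, $c\in I^K_KM$, $d\in I^H_HN$. Let $Rel\subseteq A$ be the $R$-span of all $p\cdot x$, where $x\in A$ and $p$ is a noncommutative polynomial over $R$ in the symbols $R^H_K$, $I^H_K$, $C_{g,H}$ whose value in $\mu_R(G)$ is zero. Then $M\square N:=A/(FR+Rel)$ is a left $\mu_R(G)$-module, on which $R^H_K$, $I^H_K$, $C_{g,H}$ act through the operators above, and $\square$ is functorial in both arguments. **Lemma.** For all Mackey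 functors $M,N,P$ there is a bijection $$\mathrm{Dress}(M,N;P)\;\cong\;\hom_{\mu_R(G)}(\Phi M\square\Phi N,\ \Phi P),$$ natural in $M$, $N$ and $P$. If $\theta$ corresponds to $\beta$, then for every $H\le G$ the map $\theta_{G/H}$ is the restriction of $\beta$ to the first summand $M(G/H)\otimes N(G/H)$ of the grade $H$; and $\beta$ is obtained from $\theta$ grade by grade, by $\beta(m\otimes n)=\theta_{G/H}(m\otimes n)$ on the first summand of the grade $H$ and $\beta(I^H_Kx)=I^H_K\beta(x)$ for $K<H$ and $x\in A_K$. Moreover, composition with the quotient map $A\to\Phi M\square\Phi N$ is a bijection from $\hom_{\mu_R(G)}(\Phi M\square\Phi N,\Phi P)$ to the set of $R$-linear maps $A\to\Phi P$ that commute with all $R^H_K$, $I^H_K$, $C_{g,H}$ and vanish on $FR$. -/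

import Mathlib

open CategoryTheory Opposite
open scoped TensorProduct DirectSum

universe u v w

noncomputable section

namespace MackeyBox

/-! ### Finite `G`-sets and spans -/

/-- Finite `G`-sets. -/
structure FinGSet (G : Type u) [Group G] : Type (u + 1) where
  carrier : Type u
  [action : MulAction G carrier]
  [finite : Finite carrier]

attribute [instance] FinGSet.action FinGSet.finite

section GSets

variable {G : Type u} [Group G]

instance : CoeSort (FinGSet G) (Type u) := ⟨FinGSet.carrier⟩

/-- The empty `G`-set. -/
def FinGSet.empty (G : Type u) [Group G] : FinGSet G :=
  letI : MulAction G PEmpty.{u + 1} :=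
    { smul := fun _ x => x, one_smul := fun _ => rfl, mul_smul := fun _ _ _ => rfl }
  ⟨PEmpty.{u + 1}⟩

/-- The disjoint union of two finite `G`-sets. -/
def FinGSet.sum (V W : FinGSet G) : FinGSet G := ⟨V ⊕ W⟩

/-- The pullback `{(v, w) | f v = g w}` of finite `G`-sets. -/
def FinGSet.pullback {V W Y : FinGSet G} (f : V →[G] Y) (g : W →[G] Y) : FinGSet G :=
  letI : MulAction G {p : V × W // f p.1 = g p.2} :=
    { smul := fun a p => ⟨(a • p.1.1, a • p.1.2), by
        rw [map_smul, map_smul, p.2]⟩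
      one_smul := fun p => Subtype.ext (one_smul G p.1)
      mul_smul := fun a b p => Subtype.ext (mul_smul a b p.1) }
  ⟨{p : V × W // f p.1 = g p.2}⟩

/-- The transitive `G`-set `G/H`. -/
def orbit [Finite G] (H : Subgroup G) : FinGSet G := ⟨G ⧸ H⟩

/-- A span `X ← V → Y` of finite `G`-sets. -/
structure GSpan (X Y : FinGSet G) : Type (u + 1) where
  apex : FinGSet G
  left : apex →[G] X
  right : apex →[G] Y

/-- Two spans are equivalent if their apexes are isomorphic over `X` and `Y`. -/
def GSpan.Equivalent {X Y : FinGSet G} (S T : GSpan X Y) : Prop :=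
  ∃ σ : S.apex ≃ T.apex, (∀ (g : G) (v : S.apex), σ (g • v) = g • σ v) ∧
    (∀ v, T.left (σ v) = S.left v) ∧ (∀ v, T.right (σ v) = S.right v)

instance GSpan.setoid (X Y : FinGSet G) : Setoid (GSpan X Y) where
  r := GSpan.Equivalent
  iseqv :=
    { refl := fun _ => ⟨Equiv.refl _, fun _ _ => rfl, fun _ => rfl, fun _ => rfl⟩
      symm := by
        rintro S T ⟨σ, h, hl, hr⟩
        refine ⟨σ.symm, fun g v => ?_, fun v => ?_, fun v => ?_⟩
        · rw [Equiv.symm_apply_eq, h, Equiv.apply_symm_apply]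
        · rw [← hl, Equiv.apply_symm_apply]
        · rw [← hr, Equiv.apply_symm_apply]
      trans := by
        rintro S T U ⟨σ, h, hl, hr⟩ ⟨τ, k, kl, kr⟩
        refine ⟨σ.trans τ, fun g v => ?_, fun v => ?_, fun v => ?_⟩
        · simp [h, k]
        · simp [hl, kl]
        · simp [hr, kr] }

/-- `X ← ∅ → Y`. -/
def GSpan.zero (X Y : FinGSet G) : GSpan X Y where
  apex := FinGSet.empty G
  left := { toFun := fun x => PEmpty.elim x, map_smul' := fun _ x => PEmpty.elim x }
  right := { toFun := fun x => PEmpty.elim x, map_smul' := fun _ x => PEmpty.elim x }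

/-- `X ← V ⊔ V' → Y`. -/
def GSpan.add {X Y : FinGSet G} (S T : GSpan X Y) : GSpan X Y where
  apex := S.apex.sum T.apex
  left :=
    { toFun := fun x => Sum.elim S.left T.left x
      map_smul' := by rintro g (x | x) <;> exact map_smul _ _ _ }
  right :=
    { toFun := fun x => Sum.elim S.right T.right x
      map_smul' := by rintro g (x | x) <;> exact map_smul _ _ _ }

/-- Composition of `X ← V → Y` and `Y ← W → Z` by pullback. -/
def GSpan.comp {X Y Z : FinGSet G} (S : GSpan X Y) (T : GSpan Y Z) : GSpan X Z where
  apex := FinGSet.pullback S.right T.left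
  left :=
    { toFun := fun p => S.left p.1.1
      map_smul' := fun g p => map_smul S.left g p.1.1 }
  right :=
    { toFun := fun p => T.right p.1.2
      map_smul' := fun g p => map_smul T.right g p.1.2 }

/-- The restriction span `r_f : X = X → Y`. -/
def GSpan.res {X Y : FinGSet G} (f : X →[G] Y) : GSpan X Y := ⟨X, MulActionHom.id G, f⟩

/-- The transfer span `t_f : Y ← X = X`. -/
def GSpan.tr {X Y : FinGSet G} (f : X →[G] Y) : GSpan Y X := ⟨X, f, MulActionHom.id G⟩

/-- Morphisms `X → Y` in the category `ω(G)`: equivalence classes of spans. -/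
def SpanClass (X Y : FinGSet G) : Type (u + 1) := Quotient (GSpan.setoid X Y)

/-- The class of a span. -/
def SpanClass.mk {X Y : FinGSet G} (S : GSpan X Y) : SpanClass X Y := Quotient.mk _ S

theorem SpanClass.sound {X Y : FinGSet G} {S T : GSpan X Y} (h : S.Equivalent T) :
    SpanClass.mk S = SpanClass.mk T := Quotient.sound h

theorem SpanClass.ind {X Y : FinGSet G} {p : SpanClass X Y → Prop}
    (h : ∀ S, p (SpanClass.mk S)) (x : SpanClass X Y) : p x := Quotient.ind h x

instance (X Y : FinGSet G) : Zero (SpanClass X Y) := ⟨SpanClass.mk (GSpan.zero X Y)⟩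

instance (X Y : FinGSet G) : Add (SpanClass X Y) :=
  ⟨Quotient.map₂ GSpan.add (by
    rintro S S' ⟨σ, h, hl, hr⟩ T T' ⟨τ, k, kl, kr⟩
    refine ⟨Equiv.sumCongr σ τ, ?_, ?_, ?_⟩
    · rintro g (x | x)
      · exact congrArg Sum.inl (h g x)
      · exact congrArg Sum.inr (k g x)
    · rintro (x | x)
      · exact hl x
      · exact kl x
    · rintro (x | x)
      · exact hr x
      · exact kr x)⟩

theorem SpanClass.mk_add {X Y : FinGSet G} (S T : GSpan X Y) :
    SpanClass.mk S + SpanClass.mk T = SpanClass.mk (S.add T) := rfl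

theorem SpanClass.zero_def (X Y : FinGSet G) :
    (0 : SpanClass X Y) = SpanClass.mk (GSpan.zero X Y) := rfl

theorem SpanClass.add_comm' {X Y : FinGSet G} (a b : SpanClass X Y) : a + b = b + a := by
  induction a using SpanClass.ind with | h S =>
  induction b using SpanClass.ind with | h T =>
  refine SpanClass.sound ⟨Equiv.sumComm _ _, ?_, ?_, ?_⟩ <;> try rintro g (x | x) <;> rfl
  · rintro (x | x) <;> rfl
  · rintro (x | x) <;> rfl

theorem SpanClass.zero_add' {X Y : FinGSet G} (a : SpanClass X Y) : 0 + a = a := by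
  induction a using SpanClass.ind with | h S =>
  refine SpanClass.sound ⟨Equiv.emptySum PEmpty _, ?_, ?_, ?_⟩
  · rintro g (x | x)
    · exact PEmpty.elim x
    · rfl
  · rintro (x | x)
    · exact PEmpty.elim x
    · rfl
  · rintro (x | x)
    · exact PEmpty.elim x
    · rfl

/-- Disjoint union makes `hom_{ω(G)}(X, Y)` a commutative monoid. -/
instance (X Y : FinGSet G) : AddCommMonoid (SpanClass X Y) where
  add_assoc a b c := by
    induction a using SpanClass.ind with | h S =>
    induction b using SpanClass.ind with | h T =>
    induction c using SpanClass.ind with | h U =>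
    refine SpanClass.sound ⟨Equiv.sumAssoc _ _ _, ?_, ?_, ?_⟩
    · rintro g ((x | x) | x) <;> rfl
    · rintro ((x | x) | x) <;> rfl
    · rintro ((x | x) | x) <;> rfl
  zero_add := SpanClass.zero_add'
  add_zero a := by rw [SpanClass.add_comm', SpanClass.zero_add']
  add_comm := SpanClass.add_comm'
  nsmul := nsmulRec

/-- Composition in `ω(G)`. -/
def SpanClass.comp {X Y Z : FinGSet G} : SpanClass X Y → SpanClass Y Z → SpanClass X Z :=
  Quotient.map₂ GSpan.comp (by
    rintro S S' ⟨σ, h, hl, hr⟩ T T' ⟨τ, k, kl, kr⟩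
    refine ⟨Equiv.subtypeEquiv (Equiv.prodCongr σ τ) ?_, ?_, ?_, ?_⟩
    · rintro ⟨a, b⟩
      change S.right a = T.left b ↔ S'.right (σ a) = T'.left (τ b)
      rw [hr, kl]
    · rintro g p
      exact Subtype.ext (Prod.ext (h g p.1.1) (k g p.1.2))
    · rintro p
      exact hl p.1.1
    · rintro p
      exact kr p.1.2)

theorem SpanClass.mk_comp {X Y Z : FinGSet G} (S : GSpan X Y) (T : GSpan Y Z) :
    (SpanClass.mk S).comp (SpanClass.mk T) = SpanClass.mk (S.comp T) := rfl

theorem SpanClass.add_comp {X Y Z : FinGSet G} (a b : SpanClass X Y) (c : SpanClass Y Z) :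
    (a + b).comp c = a.comp c + b.comp c := by
  induction a using SpanClass.ind with | h S =>
  induction b using SpanClass.ind with | h T =>
  induction c using SpanClass.ind with | h U =>
  refine SpanClass.sound ⟨
    { toFun := fun p => match p with
        | ⟨(Sum.inl x, y), h⟩ => Sum.inl ⟨(x, y), h⟩
        | ⟨(Sum.inr x, y), h⟩ => Sum.inr ⟨(x, y), h⟩
      invFun := fun p => match p with
        | Sum.inl q => ⟨(Sum.inl q.1.1, q.1.2), q.2⟩
        | Sum.inr q => ⟨(Sum.inr q.1.1, q.1.2), q.2⟩
      left_inv := by rintro ⟨⟨x | x, y⟩, h⟩ <;> rfl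
      right_inv := by rintro (q | q) <;> rfl }, ?_, ?_, ?_⟩
  · rintro g ⟨⟨x | x, y⟩, h⟩ <;> rfl
  · rintro ⟨⟨x | x, y⟩, h⟩ <;> rfl
  · rintro ⟨⟨x | x, y⟩, h⟩ <;> rfl

theorem SpanClass.comp_add {X Y Z : FinGSet G} (c : SpanClass X Y) (a b : SpanClass Y Z) :
    c.comp (a + b) = c.comp a + c.comp b := by
  induction a using SpanClass.ind with | h S =>
  induction b using SpanClass.ind with | h T =>
  induction c using SpanClass.ind with | h U =>
  refine SpanClass.sound ⟨
    { toFun := fun p => match p with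
        | ⟨(y, Sum.inl x), h⟩ => Sum.inl ⟨(y, x), h⟩
        | ⟨(y, Sum.inr x), h⟩ => Sum.inr ⟨(y, x), h⟩
      invFun := fun p => match p with
        | Sum.inl q => ⟨(q.1.1, Sum.inl q.1.2), q.2⟩
        | Sum.inr q => ⟨(q.1.1, Sum.inr q.1.2), q.2⟩
      left_inv := by rintro ⟨⟨y, x | x⟩, h⟩ <;> rfl
      right_inv := by rintro (q | q) <;> rfl }, ?_, ?_, ?_⟩
  · rintro g ⟨⟨y, x | x⟩, h⟩ <;> rfl
  · rintro ⟨⟨y, x | x⟩, h⟩ <;> rfl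
  · rintro ⟨⟨y, x | x⟩, h⟩ <;> rfl

theorem SpanClass.zero_comp {X Y Z : FinGSet G} (c : SpanClass Y Z) :
    (0 : SpanClass X Y).comp c = 0 := by
  induction c using SpanClass.ind with | h U =>
  exact SpanClass.sound ⟨⟨fun p => PEmpty.elim p.1.1, fun p => PEmpty.elim p,
    fun p => PEmpty.elim p.1.1, fun p => PEmpty.elim p⟩,
    fun _ p => PEmpty.elim p.1.1, fun p => PEmpty.elim p.1.1, fun p => PEmpty.elim p.1.1⟩

theorem SpanClass.comp_zero {X Y Z : FinGSet G} (c : SpanClass X Y) :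
    c.comp (0 : SpanClass Y Z) = 0 := by
  induction c using SpanClass.ind with | h U =>
  exact SpanClass.sound ⟨⟨fun p => PEmpty.elim p.1.2, fun p => PEmpty.elim p,
    fun p => PEmpty.elim p.1.2, fun p => PEmpty.elim p⟩,
    fun _ p => PEmpty.elim p.1.2, fun p => PEmpty.elim p.1.2, fun p => PEmpty.elim p.1.2⟩

/-- The identity of `X` in `ω(G)`. -/
def SpanClass.id (X : FinGSet G) : SpanClass X X :=
  SpanClass.mk ⟨X, MulActionHom.id G, MulActionHom.id G⟩

theorem SpanClass.id_comp {X Y : FinGSet G} (a : SpanClass X Y) :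
    (SpanClass.id X).comp a = a := by
  induction a using SpanClass.ind with | h S =>
  exact SpanClass.sound ⟨⟨fun p => p.1.2, fun y => ⟨(S.left y, y), rfl⟩,
    fun p => Subtype.ext (Prod.ext p.2.symm rfl), fun _ => rfl⟩,
    fun _ _ => rfl, fun p => p.2.symm, fun _ => rfl⟩

theorem SpanClass.comp_id {X Y : FinGSet G} (a : SpanClass X Y) :
    a.comp (SpanClass.id Y) = a := by
  induction a using SpanClass.ind with | h S =>
  exact SpanClass.sound ⟨⟨fun p => p.1.1, fun y => ⟨(y, S.right y), rfl⟩,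
    fun p => Subtype.ext (Prod.ext rfl p.2), fun _ => rfl⟩,
    fun _ _ => rfl, fun _ => rfl, fun p => p.2⟩

theorem SpanClass.comp_assoc {W X Y Z : FinGSet G} (a : SpanClass W X) (b : SpanClass X Y)
    (c : SpanClass Y Z) : (a.comp b).comp c = a.comp (b.comp c) := by
  induction a using SpanClass.ind with | h S =>
  induction b using SpanClass.ind with | h T =>
  induction c using SpanClass.ind with | h U =>
  exact SpanClass.sound
    ⟨⟨fun p => ⟨(p.1.1.1.1, ⟨(p.1.1.1.2, p.1.2), p.2⟩), p.1.1.2⟩,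
      fun p => ⟨(⟨(p.1.1, p.1.2.1.1), p.2⟩, p.1.2.1.2), p.1.2.2⟩,
      fun _ => rfl, fun _ => rfl⟩, fun _ _ => rfl, fun _ => rfl, fun _ => rfl⟩

/-- Composition in `ω(G)` as a biadditive map. -/
def SpanClass.compHom (X Y Z : FinGSet G) :
    SpanClass X Y →ₗ[ℕ] SpanClass Y Z →ₗ[ℕ] SpanClass X Z :=
  AddMonoidHom.toNatLinearMap
    { toFun := fun a => AddMonoidHom.toNatLinearMap
        { toFun := fun b => a.comp b
          map_zero' := SpanClass.comp_zero a
          map_add' := SpanClass.comp_add a }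
      map_zero' := by
        ext c
        exact SpanClass.zero_comp c
      map_add' := fun a b => by
        ext c
        exact SpanClass.add_comp a b c }

theorem SpanClass.compHom_apply {X Y Z : FinGSet G} (a : SpanClass X Y) (b : SpanClass Y Z) :
    SpanClass.compHom X Y Z a b = a.comp b := rfl

end GSets

/-! ### The category `Ω_R(G)` -/

/-- The category `Ω_R(G)`: its objects are the finite `G`-sets. -/
structure Omega (R : Type w) (G : Type u) [Group G] : Type (u + 1) where
  gset : FinGSet G

variable {R : Type w} [CommRing R] {G : Type u} [Group G]

/-- `hom_{Ω_R(G)}(X, Y)`: the extension of scalars from `ℕ` to `R` of the commutative monoid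
`hom_{ω(G)}(X, Y)`.  As the latter is a free commutative monoid, this is the free `R`-module on
the same basis. -/
def Omega.Hom (R : Type w) [CommRing R] (X Y : FinGSet G) : Type (max w (u + 1)) :=
  R ⊗[ℕ] SpanClass X Y

instance (X Y : FinGSet G) : AddCommMonoid (Omega.Hom R X Y) :=
  inferInstanceAs (AddCommMonoid (R ⊗[ℕ] SpanClass X Y))

instance (X Y : FinGSet G) : Module R (Omega.Hom R X Y) :=
  inferInstanceAs (Module R (R ⊗[ℕ] SpanClass X Y))

instance (X Y : FinGSet G) : AddCommGroup (Omega.Hom R X Y) :=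
  Module.addCommMonoidToAddCommGroup R

/-- `R`-bilinear extension of the composition in `ω(G)`. -/
def Omega.compAux (X Y Z : FinGSet G) :
    (R ⊗[ℕ] SpanClass X Y) →ₗ[R] (R ⊗[ℕ] SpanClass Y Z) →ₗ[R] (R ⊗[ℕ] SpanClass X Z) :=
  LinearMap.liftBaseChange R
    ((LinearMap.baseChangeHom ℕ R (SpanClass Y Z) (SpanClass X Z)) ∘ₗ SpanClass.compHom X Y Z)

/-- Composition in `Ω_R(G)`, as an `R`-bilinear map. -/
def Omega.compHom (X Y Z : FinGSet G) :
    Omega.Hom R X Y →ₗ[R] Omega.Hom R Y Z →ₗ[R] Omega.Hom R X Z :=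
  Omega.compAux X Y Z

/-- The multiple `r • [S]` of a class of spans, in `hom_{Ω_R(G)}(X, Y)`. -/
def Omega.Hom.tmul {X Y : FinGSet G} (r : R) (a : SpanClass X Y) : Omega.Hom R X Y :=
  r ⊗ₜ[ℕ] a

theorem Omega.compHom_tmul {X Y Z : FinGSet G} (r s : R) (a : SpanClass X Y)
    (b : SpanClass Y Z) :
    Omega.compHom X Y Z (Omega.Hom.tmul r a) (Omega.Hom.tmul s b)
      = Omega.Hom.tmul (r * s) (a.comp b) := by
  change Omega.compAux X Y Z (r ⊗ₜ[ℕ] a) (s ⊗ₜ[ℕ] b) = ((r * s) ⊗ₜ[ℕ] a.comp b)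
  unfold Omega.compAux
  rw [LinearMap.liftBaseChange_tmul, LinearMap.smul_apply]
  change r • (s ⊗ₜ[ℕ] a.comp b) = _
  rw [TensorProduct.smul_tmul', smul_eq_mul]

theorem Omega.Hom.induction {X Y : FinGSet G} {p : Omega.Hom R X Y → Prop}
    (h0 : p 0) (h1 : ∀ (r : R) (a : SpanClass X Y), p (Omega.Hom.tmul r a))
    (h2 : ∀ x y, p x → p y → p (x + y)) (x : Omega.Hom R X Y) : p x :=
  TensorProduct.induction_on x h0 h1 h2

theorem Omega.compHom_assoc {W X Y Z : FinGSet G} (a : Omega.Hom R W X) (b : Omega.Hom R X Y)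
    (c : Omega.Hom R Y Z) :
    Omega.compHom W Y Z (Omega.compHom W X Y a b) c =
      Omega.compHom W X Z a (Omega.compHom X Y Z b c) := by
  induction a using Omega.Hom.induction with
  | h0 => simp
  | h2 x y hx hy => simp [hx, hy]
  | h1 r a =>
    induction b using Omega.Hom.induction with
    | h0 => simp
    | h2 x y hx hy => simp [hx, hy]
    | h1 s b =>
      induction c using Omega.Hom.induction with
      | h0 => simp
      | h2 x y hx hy => simp [hx, hy]
      | h1 t c =>
        rw [Omega.compHom_tmul, Omega.compHom_tmul, Omega.compHom_tmul, Omega.compHom_tmul,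
          SpanClass.comp_assoc, mul_assoc]

theorem Omega.id_compHom {X Y : FinGSet G} (a : Omega.Hom R X Y) :
    Omega.compHom X X Y (Omega.Hom.tmul 1 (SpanClass.id X)) a = a := by
  induction a using Omega.Hom.induction with
  | h0 => simp
  | h2 x y hx hy => rw [map_add, hx, hy]
  | h1 r a => rw [Omega.compHom_tmul, SpanClass.id_comp, one_mul]

theorem Omega.compHom_id {X Y : FinGSet G} (a : Omega.Hom R X Y) :
    Omega.compHom X Y Y a (Omega.Hom.tmul 1 (SpanClass.id Y)) = a := by
  induction a using Omega.Hom.induction with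
  | h0 => simp
  | h2 x y hx hy => rw [map_add, LinearMap.add_apply, hx, hy]
  | h1 r a => rw [Omega.compHom_tmul, SpanClass.comp_id, mul_one]

instance : Category.{max w (u + 1)} (Omega R G) where
  Hom X Y := Omega.Hom R X.gset Y.gset
  id X := Omega.Hom.tmul 1 (SpanClass.id X.gset)
  comp f g := Omega.compHom _ _ _ f g
  id_comp f := Omega.id_compHom f
  comp_id f := Omega.compHom_id f
  assoc f g h := Omega.compHom_assoc f g h

instance : Preadditive (Omega R G) where
  homGroup X Y := inferInstanceAs (AddCommGroup (Omega.Hom R X.gset Y.gset))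
  add_comp X Y Z f g h := LinearMap.map_add₂ (Omega.compHom X.gset Y.gset Z.gset) f g h
  comp_add X Y Z f g h :=
    (Omega.compHom X.gset Y.gset Z.gset f).map_add g h

instance : Linear R (Omega R G) where
  homModule X Y := inferInstanceAs (Module R (Omega.Hom R X.gset Y.gset))
  smul_comp X Y Z r f g := LinearMap.map_smul₂ (Omega.compHom X.gset Y.gset Z.gset) r f g
  comp_smul X Y Z f r g :=
    (Omega.compHom X.gset Y.gset Z.gset f).map_smul r g

/-- The morphism of `Ω_R(G)` given by a span. -/
def Omega.span {X Y : Omega R G} (S : GSpan X.gset Y.gset) : X ⟶ Y :=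
  Omega.Hom.tmul 1 (SpanClass.mk S)

theorem Omega.span_comp {X Y Z : Omega R G} (S : GSpan X.gset Y.gset) (T : GSpan Y.gset Z.gset) :
    Omega.span S ≫ Omega.span T = (Omega.span (S.comp T) : X ⟶ Z) := by
  refine (Omega.compHom_tmul _ _ _ _).trans ?_
  rw [one_mul]; rfl

theorem Omega.span_eq {X Y : Omega R G} {S T : GSpan X.gset Y.gset} (h : S.Equivalent T) :
    (Omega.span S : X ⟶ Y) = Omega.span T := by
  unfold Omega.span
  rw [SpanClass.sound h]

/-- The restriction `r_f : X = X → Y` as a morphism `X ⟶ Y` of `Ω_R(G)`. -/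
def Omega.res {X Y : Omega R G} (f : X.gset →[G] Y.gset) : X ⟶ Y := Omega.span (GSpan.res f)

/-- The transfer `t_f : Y ← X = X` as a morphism `Y ⟶ X` of `Ω_R(G)`. -/
def Omega.tr {X Y : Omega R G} (f : X.gset →[G] Y.gset) : Y ⟶ X := Omega.span (GSpan.tr f)

/-! ### The Mackey algebra -/

/-- The object `G/H` of `Ω_R(G)`. -/
abbrev orb (R : Type w) [CommRing R] [Finite G] (H : Subgroup G) : Omega R G := ⟨orbit H⟩

instance subgroupFintype [Finite G] : Fintype (Subgroup G) := Fintype.ofFinite _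

variable (R G) in
/-- The Mackey algebra `μ_R(G) = ⨁_{H, K ≤ G} hom_{Ω_R(G)}(G/H, G/K)`.  As `G` has finitely many
subgroups, the direct sum is a product. -/
def MackeyAlgebra [Finite G] : Type (max w (u + 1)) :=
  ∀ H K : Subgroup G, (orb R H ⟶ orb R K)

namespace MackeyAlgebra

variable [Finite G]

instance : AddCommGroup (MackeyAlgebra R G) :=
  inferInstanceAs (AddCommGroup (∀ H K : Subgroup G, (orb R H ⟶ orb R K)))

instance : Module R (MackeyAlgebra R G) :=
  inferInstanceAs (Module R (∀ H K : Subgroup G, (orb R H ⟶ orb R K)))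

@[ext] theorem ext {a b : MackeyAlgebra R G} (h : ∀ H K, a H K = b H K) : a = b :=
  funext fun H => funext fun K => h H K

@[simp] theorem add_app (a b : MackeyAlgebra R G) (H K : Subgroup G) :
    (a + b) H K = a H K + b H K := rfl

@[simp] theorem zero_app (H K : Subgroup G) : (0 : MackeyAlgebra R G) H K = 0 := rfl

@[simp] theorem smul_app (r : R) (a : MackeyAlgebra R G) (H K : Subgroup G) :
    (r • a) H K = r • a H K := rfl

open Classical in
/-- A morphism `G/H → G/K` as an element of the Mackey algebra. -/
def single (H K : Subgroup G) (f : orb R H ⟶ orb R K) : MackeyAlgebra R G :=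
  Pi.single H (Pi.single K f)

/-- Multiplication is composition of composable components (in the order of the diagrams), and
zero on non-composable ones. -/
instance : Mul (MackeyAlgebra R G) := ⟨fun a b H L => ∑ K, a H K ≫ b K L⟩

open Classical in
instance : One (MackeyAlgebra R G) := ⟨∑ H, single H H (𝟙 _)⟩

theorem mul_app (a b : MackeyAlgebra R G) (H L : Subgroup G) :
    (a * b) H L = ∑ K, a H K ≫ b K L := rfl

theorem single_same (H K : Subgroup G) (f : orb R H ⟶ orb R K) : single H K f H K = f := by
  simp [single]

theorem single_of_ne_left {H K H' : Subgroup G} (f : orb R H ⟶ orb R K) (h : H' ≠ H)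
    (K' : Subgroup G) : single H K f H' K' = 0 := by
  simp [single, h]

theorem single_of_ne_right {H K K' : Subgroup G} (f : orb R H ⟶ orb R K) (h : K' ≠ K)
    (H' : Subgroup G) : single H K f H' K' = 0 := by
  by_cases hH : H' = H
  · subst hH
    simp [single, h]
  · exact single_of_ne_left f hH K'

@[simp] theorem sum_app {ι : Type*} (s : Finset ι) (f : ι → MackeyAlgebra R G)
    (H K : Subgroup G) : (∑ i ∈ s, f i) H K = ∑ i ∈ s, f i H K := by
  classical
  induction s using Finset.induction_on with
  | empty => simp
  | insert i s hi ih => rw [Finset.sum_insert hi, Finset.sum_insert hi, add_app, ih]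

theorem one_app_same (H : Subgroup G) : (1 : MackeyAlgebra R G) H H = 𝟙 _ := by
  change (∑ K, single K K (𝟙 _) : MackeyAlgebra R G) H H = _
  rw [sum_app, Finset.sum_eq_single H, single_same]
  · intro K _ hK
    exact single_of_ne_left _ (Ne.symm hK) _
  · simp

theorem one_app_ne {H K : Subgroup G} (h : H ≠ K) : (1 : MackeyAlgebra R G) H K = 0 := by
  change (∑ L, single L L (𝟙 _) : MackeyAlgebra R G) H K = _
  rw [sum_app]
  refine Finset.sum_eq_zero fun L _ => ?_
  by_cases hL : H = L
  · subst hL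
    exact single_of_ne_right _ (Ne.symm h) _
  · exact single_of_ne_left _ hL _

instance : Ring (MackeyAlgebra R G) :=
  { (inferInstance : AddCommGroup (MackeyAlgebra R G)) with
    mul := (· * ·)
    one := 1
    left_distrib := fun a b c => by
      ext H L
      simp [mul_app, Finset.sum_add_distrib]
    right_distrib := fun a b c => by
      ext H L
      simp [mul_app, Finset.sum_add_distrib]
    zero_mul := fun a => by
      ext H L
      simp [mul_app]
    mul_zero := fun a => by
      ext H L
      simp [mul_app]
    mul_assoc := fun a b c => by
      ext H L
      simp only [mul_app, Preadditive.sum_comp, Preadditive.comp_sum, Category.assoc]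
      exact Finset.sum_comm
    one_mul := fun a => by
      ext H L
      rw [mul_app, Finset.sum_eq_single H, one_app_same, Category.id_comp]
      · intro K _ hK
        rw [one_app_ne (Ne.symm hK), Limits.zero_comp]
      · simp
    mul_one := fun a => by
      ext H L
      rw [mul_app, Finset.sum_eq_single L, one_app_same, Category.comp_id]
      · intro K _ hK
        rw [one_app_ne hK, Limits.comp_zero]
      · simp }

instance : Algebra R (MackeyAlgebra R G) :=
  Algebra.ofModule
    (fun r a b => by
      ext H L
      simp [mul_app, Finset.smul_sum])
    (fun r a b => by
      ext H L
      simp [mul_app, Finset.smul_sum])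

theorem single_mul_single (H K L : Subgroup G) (f : orb R H ⟶ orb R K) (g : orb R K ⟶ orb R L) :
    single H K f * single K L g = single H L (f ≫ g) := by
  ext A B
  rw [mul_app, Finset.sum_eq_single K]
  · by_cases hA : A = H
    · subst hA
      by_cases hB : B = L
      · subst hB
        simp only [single_same]
      · simp only [single_of_ne_right _ hB, Limits.comp_zero]
    · simp only [single_of_ne_left _ hA, Limits.zero_comp]
  · intro J _ hJ
    rw [single_of_ne_right _ hJ, Limits.zero_comp]
  · simp

theorem single_add (H K : Subgroup G) (f g : orb R H ⟶ orb R K) :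
    single H K (f + g) = single H K f + single H K g := by
  simp only [single, Pi.single_add]
  rfl

theorem single_smul (H K : Subgroup G) (r : R) (f : orb R H ⟶ orb R K) :
    single H K (r • f) = r • single H K f := by
  simp only [single, Pi.single_smul]
  rfl

theorem eq_sum_single (a : MackeyAlgebra R G) : a = ∑ H, ∑ K, single H K (a H K) := by
  ext A B
  rw [sum_app, Finset.sum_eq_single A, sum_app, Finset.sum_eq_single B, single_same]
  · intro K _ hK
    exact single_of_ne_right _ (Ne.symm hK) _
  · simp
  · intro H _ hH
    rw [sum_app]
    exact Finset.sum_eq_zero fun K _ => single_of_ne_left _ (Ne.symm hH) _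
  · simp

end MackeyAlgebra

/-! ### The elements `R^H_K`, `I^H_K` and `C_{g,H}` -/

/-- The conjugate subgroup `ᵍH = g H g⁻¹`. -/
def conj (g : G) (H : Subgroup G) : Subgroup G := H.map (MulAut.conj g).toMonoidHom

theorem mem_conj {g x : G} {H : Subgroup G} : x ∈ conj g H ↔ g⁻¹ * x * g ∈ H := by
  unfold conj
  rw [Subgroup.mem_map]
  constructor
  · rintro ⟨y, hy, rfl⟩
    simpa [mul_assoc] using hy
  · intro h
    exact ⟨_, h, by simp [mul_assoc]⟩

theorem conj_mono (g : G) {K H : Subgroup G} (h : K ≤ H) : conj g K ≤ conj g H :=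
  Subgroup.map_mono h

theorem conj_lt (g : G) {K H : Subgroup G} (h : K < H) : conj g K < conj g H :=
  (Subgroup.map_lt_map_iff_of_injective (MulAut.conj g).injective).2 h

section Finite

variable [Finite G]

/-- The canonical map `π^H_K : G/K → G/H`. -/
def proj {K H : Subgroup G} (h : K ≤ H) : orbit K →[G] orbit H where
  toFun := Subgroup.quotientMapOfLE h
  map_smul' g x := by
    induction x using Quotient.inductionOn'
    rfl

/-- The conjugation map `c_{g,H} : G/H → G/ᵍH`, `kH ↦ (k g⁻¹) ᵍH`. -/
def cmap (g : G) (H : Subgroup G) : orbit H →[G] orbit (conj g H) where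
  toFun := fun x => Quotient.liftOn' x (fun k => ((k * g⁻¹ : G) : G ⧸ conj g H)) (by
    intro a b hab
    rw [QuotientGroup.leftRel_apply] at hab
    refine QuotientGroup.eq.2 (mem_conj.2 ?_)
    simpa [mul_assoc] using hab)
  map_smul' a x := by
    induction x using Quotient.inductionOn'
    exact congrArg (fun z : G => (z : G ⧸ conj g H)) (mul_assoc _ _ _)

namespace MackeyAlgebra

/-- `R^H_K`. -/
def resEl {K H : Subgroup G} (h : K ≤ H) : MackeyAlgebra R G :=
  single K H (Omega.res (X := orb R K) (Y := orb R H) (proj h))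

/-- `I^H_K`. -/
def indEl {K H : Subgroup G} (h : K ≤ H) : MackeyAlgebra R G :=
  single H K (Omega.tr (X := orb R K) (Y := orb R H) (proj h))

/-- `C_{g,H}`. -/
def conEl (g : G) (H : Subgroup G) : MackeyAlgebra R G :=
  single (conj g H) H (Omega.tr (X := orb R H) (Y := orb R (conj g H)) (cmap g H))

theorem tr_proj_self (H : Subgroup G) :
    Omega.tr (X := orb R H) (Y := orb R H) (proj (le_refl H)) = 𝟙 (orb R H) := by
  refine (Omega.span_eq (T := ⟨orbit H, MulActionHom.id G, MulActionHom.id G⟩) ?_).trans rfl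
  refine ⟨Equiv.refl _, fun _ _ => rfl, fun v => ?_, fun _ => rfl⟩
  induction v using Quotient.inductionOn'
  rfl

theorem indEl_self (H : Subgroup G) : (indEl (le_refl H) : MackeyAlgebra R G) = single H H (𝟙 _) := by
  unfold indEl
  rw [tr_proj_self]

theorem indEl_self_mul_single (H K : Subgroup G) (f : orb R H ⟶ orb R K) :
    indEl (le_refl H) * single H K f = single H K f := by
  rw [indEl_self, single_mul_single, Category.id_comp]

end MackeyAlgebra

end Finite

/-- Symbols for the elements `R^H_K`, `I^H_K` (`K ≤ H`) and `C_{g,H}`. -/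
inductive Gen (G : Type u) [Group G] : Type u
  | res (K H : Subgroup G) (h : K ≤ H)
  | ind (K H : Subgroup G) (h : K ≤ H)
  | con (g : G) (H : Subgroup G)

/-- The element of the Mackey algebra named by a symbol. -/
def Gen.elem (R : Type w) [CommRing R] [Finite G] : Gen G → MackeyAlgebra R G
  | .res _ _ h => MackeyAlgebra.resEl h
  | .ind _ _ h => MackeyAlgebra.indEl h
  | .con g H => MackeyAlgebra.conEl g H

/-- The evaluation of noncommutative polynomials in the symbols in `μ_R(G)`. -/
def evalGen (R : Type w) [CommRing R] (G : Type u) [Group G] [Finite G] :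
    FreeAlgebra R (Gen G) →ₐ[R] MackeyAlgebra R G :=
  FreeAlgebra.lift R (Gen.elem R)

theorem Omega.tr_comp_tr {X Y Z : Omega R G} (f : X.gset →[G] Y.gset) (g : Y.gset →[G] Z.gset) :
    (Omega.tr g : Z ⟶ Y) ≫ Omega.tr f = Omega.tr (g.comp f) := by
  unfold Omega.tr
  rw [Omega.span_comp]
  exact Omega.span_eq ⟨⟨fun p => p.1.2, fun x => ⟨(f x, x), rfl⟩,
    fun p => Subtype.ext (Prod.ext p.2.symm rfl), fun _ => rfl⟩, fun _ _ => rfl,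
    fun p => congrArg g p.2.symm, fun _ => rfl⟩

theorem Omega.tr_comp_res {X Y Z : Omega R G} (f : Y.gset →[G] X.gset) (g : Y.gset →[G] Z.gset) :
    (Omega.tr f : X ⟶ Y) ≫ Omega.res g = Omega.span ⟨Y.gset, f, g⟩ := by
  unfold Omega.tr Omega.res
  rw [Omega.span_comp]
  exact Omega.span_eq ⟨⟨fun p => p.1.2, fun x => ⟨(x, x), rfl⟩,
    fun p => Subtype.ext (Prod.ext p.2.symm rfl), fun _ => rfl⟩, fun _ _ => rfl,
    fun p => congrArg f p.2.symm, fun _ => rfl⟩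

/-- The restriction of a span to a `G`-stable part of its middle term. -/
def GSpan.restrict {X Y : FinGSet G} (S : GSpan X Y) (p : S.apex → Prop)
    (hp : ∀ (g : G) x, p x → p (g • x)) : GSpan X Y :=
  letI : MulAction G {x : S.apex // p x} :=
    { smul := fun g x => ⟨g • x.1, hp g x.1 x.2⟩
      one_smul := fun x => Subtype.ext (one_smul G x.1)
      mul_smul := fun a b x => Subtype.ext (mul_smul a b x.1) }
  { apex := ⟨{x : S.apex // p x}⟩
    left := { toFun := fun x => S.left x.1, map_smul' := fun g x => map_smul S.left g x.1 }
    right := { toFun := fun x => S.right x.1, map_smul' := fun g x => map_smul S.right g x.1 } }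

theorem Omega.span_add {X Y : Omega R G} (S T : GSpan X.gset Y.gset) :
    (Omega.span (S.add T) : X ⟶ Y) = Omega.span S + Omega.span T :=
  TensorProduct.tmul_add (R := ℕ) (1 : R) (SpanClass.mk S) (SpanClass.mk T)

theorem Omega.span_zero (X Y : Omega R G) :
    (Omega.span (GSpan.zero X.gset Y.gset) : X ⟶ Y) = 0 :=
  TensorProduct.tmul_zero (R := ℕ) (SpanClass X.gset Y.gset) (1 : R)

section Surjective

variable [Finite G]

theorem evalGen_ι (s : Gen G) : evalGen R G (FreeAlgebra.ι R s) = s.elem R := by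
  simp [evalGen]

theorem MackeyAlgebra.single_zero (H K : Subgroup G) :
    MackeyAlgebra.single H K (0 : orb R H ⟶ orb R K) = 0 := by
  simpa using MackeyAlgebra.single_smul H K (0 : R) (0 : orb R H ⟶ orb R K)

open MackeyAlgebra in
/-- A span with transitive middle term is a product of the special elements. -/
theorem single_orbit_mem {H K : Subgroup G} (S : GSpan (orbit H) (orbit K)) (x : S.apex)
    (hx : ∀ y : S.apex, ∃ g : G, g • x = y) :
    single H K (Omega.span (X := orb R H) (Y := orb R K) S) ∈ (evalGen R G).range := by
  obtain ⟨b, hb⟩ := QuotientGroup.mk_surjective (S.right x : G ⧸ K)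
  obtain ⟨x', hx', hK, hr⟩ : ∃ x' : S.apex, (∀ y : S.apex, ∃ g : G, g • x' = y) ∧
      MulAction.stabilizer G x' ≤ K ∧ S.right x' = ((1 : G) : G ⧸ K) := by
    have h1 : S.right (b⁻¹ • x) = ((1 : G) : G ⧸ K) := by
      rw [map_smul, ← hb]
      exact congrArg (fun z : G => (z : G ⧸ K)) (inv_mul_cancel b)
    refine ⟨b⁻¹ • x, fun y => ?_, fun g hg => ?_, h1⟩
    · obtain ⟨g, rfl⟩ := hx y
      exact ⟨g * b, by simp [mul_smul]⟩
    · have h2 : g • S.right (b⁻¹ • x) = S.right (b⁻¹ • x) := by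
        rw [← map_smul, MulAction.mem_stabilizer_iff.1 hg]
      rw [h1] at h2
      have h3 : ((g * 1 : G) : G ⧸ K) = ((1 : G) : G ⧸ K) := h2
      rw [QuotientGroup.eq] at h3
      simpa using h3
  clear hx hb
  obtain ⟨a, ha⟩ := QuotientGroup.mk_surjective (S.left x' : G ⧸ H)
  set L := MulAction.stabilizer G x' with hL
  have hH : conj a⁻¹ L ≤ H := by
    intro z hz
    rw [mem_conj] at hz
    have h2 : (a⁻¹⁻¹ * z * a⁻¹) • S.left x' = S.left x' := by
      rw [← map_smul, MulAction.mem_stabilizer_iff.1 hz]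
    rw [← ha] at h2
    have h3 : ((a⁻¹⁻¹ * z * a⁻¹ * a : G) : G ⧸ H) = ((a : G) : G ⧸ H) := h2
    rw [QuotientGroup.eq] at h3
    simpa [mul_assoc] using H.inv_mem h3
  have key : single H K (Omega.span (X := orb R H) (Y := orb R K) S) =
      indEl hH * conEl a⁻¹ L * (resEl hK : MackeyAlgebra R G) := by
    unfold indEl conEl resEl
    rw [single_mul_single, single_mul_single, Omega.tr_comp_tr, Omega.tr_comp_res]
    congr 1
    refine (Omega.span_eq ⟨Equiv.ofBijective (MulAction.ofQuotientStabilizer G x')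
      ⟨MulAction.injective_ofQuotientStabilizer G x', fun y => ?_⟩, ?_, ?_, ?_⟩).symm
    · obtain ⟨g, rfl⟩ := hx' y
      exact ⟨(g : G ⧸ L), rfl⟩
    · intro g v
      induction v using Quotient.inductionOn' with | h k =>
      exact mul_smul g k x'
    · intro v
      induction v using Quotient.inductionOn' with | h k =>
      change S.left (k • x') = ((k * a⁻¹⁻¹ : G) : G ⧸ H)
      rw [map_smul, ← ha, inv_inv]
      rfl
    · intro v
      induction v using Quotient.inductionOn' with | h k =>
      change S.right (k • x') = ((k : G) : G ⧸ K)
      rw [map_smul, hr]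
      exact congrArg (fun z : G => (z : G ⧸ K)) (mul_one k)
  rw [key]
  exact mul_mem (mul_mem ⟨FreeAlgebra.ι R (.ind _ _ hH), evalGen_ι _⟩
    ⟨FreeAlgebra.ι R (.con _ _), evalGen_ι _⟩) ⟨FreeAlgebra.ι R (.res _ _ hK), evalGen_ι _⟩

open MackeyAlgebra in
theorem single_span_mem {H K : Subgroup G} (n : ℕ) (S : GSpan (orbit H) (orbit K))
    (hn : Nat.card S.apex ≤ n) :
    single H K (Omega.span (X := orb R H) (Y := orb R K) S) ∈ (evalGen R G).range := by
  induction n generalizing S with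
  | zero =>
    have hE : IsEmpty S.apex := Finite.card_eq_zero_iff.1 (Nat.le_zero.1 hn)
    have h0 : Omega.span (X := orb R H) (Y := orb R K) S = 0 := by
      refine (Omega.span_eq (T := GSpan.zero (orbit H) (orbit K)) ?_).trans
        (Omega.span_zero (orb R H) (orb R K))
      exact ⟨⟨fun x => (hE.false x).elim, fun x => PEmpty.elim x, fun x => (hE.false x).elim,
        fun x => PEmpty.elim x⟩, fun _ x => (hE.false x).elim, fun x => (hE.false x).elim,
        fun x => (hE.false x).elim⟩
    rw [h0, MackeyAlgebra.single_zero]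
    exact zero_mem _
  | succ n ih =>
    by_cases hE : IsEmpty S.apex
    · exact ih S (by rw [Finite.card_eq_zero_iff.2 hE]; exact Nat.zero_le _)
    · obtain ⟨x⟩ := not_isEmpty_iff.1 hE
      classical
      have hp : ∀ (g : G) y, (∃ k : G, k • x = y) → ∃ k : G, k • x = g • y := by
        rintro g y ⟨k, rfl⟩
        exact ⟨g * k, mul_smul g k x⟩
      have hq : ∀ (g : G) y, (¬ ∃ k : G, k • x = y) → ¬ ∃ k : G, k • x = g • y := by
        rintro g y h ⟨k, hk⟩
        exact h ⟨g⁻¹ * k, by rw [mul_smul, hk, inv_smul_smul]⟩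
      have hS : Omega.span (X := orb R H) (Y := orb R K) S =
          Omega.span (X := orb R H) (Y := orb R K) (S.restrict _ hp) +
            Omega.span (X := orb R H) (Y := orb R K) (S.restrict _ hq) := by
        rw [← Omega.span_add]
        refine (Omega.span_eq ⟨Equiv.sumCompl (fun y => ∃ k : G, k • x = y), ?_, ?_, ?_⟩).symm
        · rintro g (y | y) <;> rfl
        · rintro (y | y) <;> rfl
        · rintro (y | y) <;> rfl
      rw [hS, MackeyAlgebra.single_add]
      refine add_mem (single_orbit_mem _ ⟨x, 1, one_smul G x⟩ ?_) (ih _ ?_)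
      · rintro ⟨y, k, rfl⟩
        exact ⟨k, rfl⟩
      · have h1 : Nat.card {y : S.apex // ¬ ∃ k : G, k • x = y} < Nat.card S.apex :=
          Finite.card_subtype_lt (x := x) (by simpa using ⟨1, one_smul G x⟩)
        exact Nat.lt_succ_iff.1 (lt_of_lt_of_le h1 hn)

/-- The Mackey algebra is generated by the elements `R^H_K`, `I^H_K`, `C_{g,H}`. -/
theorem evalGen_surjective : Function.Surjective (evalGen R G) := by
  rw [← AlgHom.range_eq_top, eq_top_iff]
  intro a _
  rw [MackeyAlgebra.eq_sum_single a]
  refine sum_mem fun H _ => sum_mem fun K _ => ?_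
  generalize a H K = f
  change Omega.Hom R (orbit H) (orbit K) at f
  induction f using Omega.Hom.induction with
  | h0 =>
    exact (MackeyAlgebra.single_zero (R := R) H K) ▸ zero_mem _
  | h2 x y hx hy =>
    exact (MackeyAlgebra.single_add H K (x : orb R H ⟶ orb R K) y) ▸ add_mem hx hy
  | h1 r b =>
    induction b using SpanClass.ind with | h S =>
    have : (Omega.Hom.tmul r (SpanClass.mk S) : orb R H ⟶ orb R K) =
        r • Omega.span (X := orb R H) (Y := orb R K) S := by
      change (r ⊗ₜ[ℕ] SpanClass.mk S : R ⊗[ℕ] SpanClass (orbit H) (orbit K)) =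
        r • ((1 : R) ⊗ₜ[ℕ] SpanClass.mk S : R ⊗[ℕ] SpanClass (orbit H) (orbit K))
      rw [TensorProduct.smul_tmul', smul_eq_mul, mul_one]
    have h := Subalgebra.smul_mem _ (single_span_mem (R := R) _ S le_rfl) r
    rw [← MackeyAlgebra.single_smul, ← this] at h
    exact h

end Surjective

/-! ### The box product of two left `μ_R(G)`-modules -/

section Grade

variable [Finite G] {M : Type*} [AddCommGroup M] [Module R M] [Module (MackeyAlgebra R G) M]
  [IsScalarTower R (MackeyAlgebra R G) M]

variable (R M) in
/-- The grade `I^H_H M` of a left `μ_R(G)`-module `M`. -/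
def grade (H : Subgroup G) : Submodule R M :=
  LinearMap.range (Algebra.lsmul R R M (MackeyAlgebra.indEl (le_refl H) : MackeyAlgebra R G))

theorem mem_grade {H : Subgroup G} {x : M} :
    x ∈ grade R M H ↔ (MackeyAlgebra.indEl (le_refl H) : MackeyAlgebra R G) • x = x := by
  constructor
  · rintro ⟨y, rfl⟩
    change (MackeyAlgebra.indEl (le_refl H) : MackeyAlgebra R G) •
      ((MackeyAlgebra.indEl (le_refl H) : MackeyAlgebra R G) • y) =
      (MackeyAlgebra.indEl (le_refl H) : MackeyAlgebra R G) • y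
    rw [← mul_smul, MackeyAlgebra.indEl_self, MackeyAlgebra.single_mul_single, Category.id_comp]
  · intro h
    exact ⟨x, h⟩

variable (M) in
/-- Multiplication by an element of `hom_{Ω_R(G)}(G/H, G/K)`, as a map `I^K_K M → I^H_H M`. -/
def gradeMul {H K : Subgroup G} (f : orb R H ⟶ orb R K) : grade R M K →ₗ[R] grade R M H :=
  ((Algebra.lsmul R R M (MackeyAlgebra.single H K f)).comp (grade R M K).subtype).codRestrict _
    (fun x => mem_grade.2 (by
      change MackeyAlgebra.indEl (le_refl H) • (MackeyAlgebra.single H K f • (x : M)) =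
        MackeyAlgebra.single H K f • (x : M)
      rw [← mul_smul, MackeyAlgebra.indEl_self_mul_single]))

variable (R M) in
/-- `R^H_K : I^H_H M → I^K_K M`. -/
def gradeRes {K H : Subgroup G} (h : K ≤ H) : grade R M H →ₗ[R] grade R M K :=
  gradeMul M (Omega.res (X := orb R K) (Y := orb R H) (proj h))

variable (R M) in
/-- `I^H_K : I^K_K M → I^H_H M`. -/
def gradeInd {K H : Subgroup G} (h : K ≤ H) : grade R M K →ₗ[R] grade R M H :=
  gradeMul M (Omega.tr (X := orb R K) (Y := orb R H) (proj h))

variable (R M) in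
/-- `C_{g,H} : I^H_H M → I^{ᵍH}_{ᵍH} M`. -/
def gradeCon (g : G) (H : Subgroup G) : grade R M H →ₗ[R] grade R M (conj g H) :=
  gradeMul M (Omega.tr (X := orb R H) (Y := orb R (conj g H)) (cmap g H))

theorem coe_gradeRes {K H : Subgroup G} (h : K ≤ H) (x : grade R M H) :
    (gradeRes R M h x : M) = (MackeyAlgebra.resEl h : MackeyAlgebra R G) • (x : M) := rfl

theorem coe_gradeInd {K H : Subgroup G} (h : K ≤ H) (x : grade R M K) :
    (gradeInd R M h x : M) = (MackeyAlgebra.indEl h : MackeyAlgebra R G) • (x : M) := rfl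

theorem coe_gradeCon (g : G) (H : Subgroup G) (x : grade R M H) :
    (gradeCon R M g H x : M) = (MackeyAlgebra.conEl g H : MackeyAlgebra R G) • (x : M) := rfl

/-- A map of `μ_R(G)`-modules preserves grades. -/
def gradeMap {M' : Type*} [AddCommGroup M'] [Module R M'] [Module (MackeyAlgebra R G) M']
    [IsScalarTower R (MackeyAlgebra R G) M'] (f : M →ₗ[MackeyAlgebra R G] M') (H : Subgroup G) :
    grade R M H →ₗ[R] grade R M' H :=
  ((f.restrictScalars R).comp (grade R M H).subtype).codRestrict _
    (fun x => mem_grade.2 (by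
      change MackeyAlgebra.indEl (le_refl H) • f (x : M) = f (x : M)
      rw [← map_smul, mem_grade.1 x.2]))

end Grade

/-- Strict chains of subgroups `K₀ < K₁ < ⋯ < Kₙ = H` (`n ≥ 0`) ending in `H`. -/
inductive SubChain {G : Type u} [Group G] : Subgroup G → Type u
  | base (H : Subgroup G) : SubChain H
  | step {K H : Subgroup G} (h : K < H) (c : SubChain K) : SubChain H

/-- The smallest member `K₀` of a chain. -/
def SubChain.bot : {H : Subgroup G} → SubChain H → Subgroup G
  | _, .base H => H
  | _, .step _ c => c.bot

/-- For subgroups `J`, `K ≤ H`, the set of double cosets `J \ H / K`. -/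
abbrev DCos (J H K : Subgroup G) : Type u :=
  DoubleCoset.Quotient (J.subgroupOf H : Set H) (K.subgroupOf H : Set H)

/-- A chosen representative of a double coset in `J \ H / K`. -/
def DCos.rep {J H K : Subgroup G} (q : DCos J H K) : G := ((Quotient.out q : H) : G)

instance [Finite G] (J H K : Subgroup G) : Fintype (DCos J H K) :=
  haveI : Finite (DCos J H K) := Quotient.finite _
  Fintype.ofFinite _

/-- `ᵍ(K ∩ Jᵍ) ≤ J`, where `Jᵍ = g⁻¹ J g`.  (In fact `ᵍ(K ∩ Jᵍ) = ᵍK ∩ J`.) -/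
theorem conj_inf_le (g : G) (K J : Subgroup G) : conj g (K ⊓ conj g⁻¹ J) ≤ J := by
  intro x hx
  have h := (mem_conj.1 (Subgroup.mem_inf.1 (mem_conj.1 hx)).2)
  simpa [mul_assoc] using h

section Box

variable [Finite G] (R) (M : Type*) [AddCommGroup M] [Module R M] [Module (MackeyAlgebra R G) M]
  [IsScalarTower R (MackeyAlgebra R G) M] (N : Type*) [AddCommGroup N] [Module R N]
  [Module (MackeyAlgebra R G) N] [IsScalarTower R (MackeyAlgebra R G) N]

/-- `(I^H_H M) ⊗_R (I^H_H N)`. -/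
abbrev Tens (H : Subgroup G) := grade R M H ⊗[R] grade R N H

/-- The `R`-module `A_H`, defined inductively by
`A_H = (I^H_H M ⊗ I^H_H N) ⊕ ⨁_{K < H} A_K`.  Unfolding the induction, `A_H` has one summand
`I^{K₀}_{K₀} M ⊗ I^{K₀}_{K₀} N` for each strict chain `K₀ < ⋯ < Kₙ = H`, and this is how it is
encoded; `BoxGrade.recEquiv` is the inductive description. -/
def BoxGrade (H : Subgroup G) := ⨁ c : SubChain H, Tens R M N c.bot

instance (H : Subgroup G) : AddCommGroup (BoxGrade R M N H) :=
  inferInstanceAs (AddCommGroup (⨁ c : SubChain H, Tens R M N c.bot))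

instance (H : Subgroup G) : Module R (BoxGrade R M N H) :=
  inferInstanceAs (Module R (⨁ c : SubChain H, Tens R M N c.bot))

namespace BoxGrade

open Classical in
/-- The inclusion of the summand of `A_H` that belongs to a chain. -/
def inc {H : Subgroup G} (c : SubChain H) : Tens R M N c.bot →ₗ[R] BoxGrade R M N H :=
  DirectSum.lof R (SubChain H) (fun c => Tens R M N c.bot) c

open Classical in
/-- The map out of `A_H` given by maps on the summands. -/
def lift {H : Subgroup G} {Q : Type*} [AddCommGroup Q] [Module R Q]
    (φ : ∀ c : SubChain H, Tens R M N c.bot →ₗ[R] Q) : BoxGrade R M N H →ₗ[R] Q :=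
  DirectSum.toModule R (SubChain H) Q φ

theorem lift_inc {H : Subgroup G} {Q : Type*} [AddCommGroup Q] [Module R Q]
    (φ : ∀ c : SubChain H, Tens R M N c.bot →ₗ[R] Q) (c : SubChain H) (x : Tens R M N c.bot) :
    lift R M N φ (inc R M N c x) = φ c x := by
  classical
  exact DirectSum.toModule_lof R (M := fun c : SubChain H => Tens R M N c.bot) (φ := φ) c x

theorem hom_ext {H : Subgroup G} {Q : Type*} [AddCommGroup Q] [Module R Q]
    {f g : BoxGrade R M N H →ₗ[R] Q} (h : ∀ c x, f (inc R M N c x) = g (inc R M N c x)) :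
    f = g := by
  classical
  exact DirectSum.linearMap_ext R fun c => LinearMap.ext (h c)

/-- The inclusion of the first summand `I^H_H M ⊗ I^H_H N` of `A_H`. -/
def first (H : Subgroup G) : Tens R M N H →ₗ[R] BoxGrade R M N H :=
  inc R M N (SubChain.base H)

/-- For `K < H`, the inclusion of the summand `A_K` of `A_H`. -/
def up {K H : Subgroup G} (h : K < H) : BoxGrade R M N K →ₗ[R] BoxGrade R M N H :=
  lift R M N fun c => inc R M N (SubChain.step h c)

theorem up_inc {K H : Subgroup G} (h : K < H) (c : SubChain K) (x : Tens R M N c.bot) :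
    up R M N h (inc R M N c x) = inc R M N (SubChain.step h c) x :=
  lift_inc R M N _ c x

/-- `⨁_{K < H} A_K`. -/
abbrev Proper (H : Subgroup G) := ⨁ K : {K : Subgroup G // K < H}, BoxGrade R M N K.1

open Classical in
/-- The summand `A_K` of `⨁_{K < H} A_K`. -/
def properInc {K H : Subgroup G} (h : K < H) : BoxGrade R M N K →ₗ[R] Proper R M N H :=
  DirectSum.lof R {K : Subgroup G // K < H} (fun K => BoxGrade R M N K.1) ⟨K, h⟩

open Classical in
/-- The inclusions of the `A_K`, `K < H`, in `A_H`. -/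
def properMap (H : Subgroup G) : Proper R M N H →ₗ[R] BoxGrade R M N H :=
  DirectSum.toModule R {K : Subgroup G // K < H} (BoxGrade R M N H) fun K => up R M N K.2

theorem properMap_inc {K H : Subgroup G} (h : K < H) (x : BoxGrade R M N K) :
    properMap R M N H (properInc R M N h x) = up R M N h x := by
  classical
  exact DirectSum.toModule_lof R (M := fun K : {K : Subgroup G // K < H} => BoxGrade R M N K.1)
    (φ := fun K => up R M N K.2) ⟨K, h⟩ x

/-- The components of `recEquiv`. -/
def recMap : {H : Subgroup G} → (c : SubChain H) →
    (Tens R M N c.bot →ₗ[R] Tens R M N H × Proper R M N H)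
  | H, .base _ => LinearMap.inl R (Tens R M N H) (Proper R M N H)
  | H, .step h c => LinearMap.inr R (Tens R M N H) (Proper R M N H) ∘ₗ properInc R M N h ∘ₗ
      inc R M N c

/-- The inductive description `A_H ≅ (I^H_H M ⊗ I^H_H N) ⊕ ⨁_{K < H} A_K`. -/
def recEquiv (H : Subgroup G) : BoxGrade R M N H ≃ₗ[R] Tens R M N H × Proper R M N H :=
  LinearEquiv.ofLinearMap
    (lift R M N fun c => recMap R M N c)
    (LinearMap.coprod (first R M N H) (properMap R M N H))
    (by
      refine LinearMap.prod_ext (LinearMap.ext fun x => ?_) ?_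
      · change lift R M N _ (LinearMap.coprod (first R M N H) (properMap R M N H) (x, 0)) = (x, 0)
        rw [LinearMap.coprod_apply, map_zero, add_zero]
        exact lift_inc R M N _ (SubChain.base H) x
      · classical
        refine DirectSum.linearMap_ext R fun K => hom_ext R M N fun c x => ?_
        change lift R M N _ (LinearMap.coprod (first R M N H) (properMap R M N H)
          (0, properInc R M N K.2 (inc R M N c x))) = (0, properInc R M N K.2 (inc R M N c x))
        rw [LinearMap.coprod_apply, map_zero, zero_add, properMap_inc, up_inc]
        exact lift_inc R M N _ (SubChain.step K.2 c) x)
    (by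
      refine hom_ext R M N fun c x => ?_
      rw [LinearMap.comp_apply, lift_inc]
      cases c with
      | base =>
        change LinearMap.coprod (first R M N H) (properMap R M N H) (x, 0) = first R M N H x
        rw [LinearMap.coprod_apply, map_zero, add_zero]
      | step h c =>
        change LinearMap.coprod (first R M N H) (properMap R M N H)
          (0, properInc R M N h (inc R M N c x)) = inc R M N (SubChain.step h c) x
        rw [LinearMap.coprod_apply, map_zero, zero_add, properMap_inc]
        exact up_inc R M N h c x)

open Classical in
/-- `I^H_K` on the grade `K`: the identity if `K = H`, and the inclusion of `A_K` in `A_H` if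
`K < H`. -/
def ind {K H : Subgroup G} (h : K ≤ H) : BoxGrade R M N K →ₗ[R] BoxGrade R M N H :=
  if e : K = H then e ▸ LinearMap.id else up R M N (lt_of_le_of_ne h e)

/-- `C_{g,H}` on the summands of the grade `H`:
`C_{g,H}(m ⊗ n) = C_{g,H} m ⊗ C_{g,H} n` and `C_{g,H} I^H_K x = I^{ᵍH}_{ᵍK} C_{g,K} x`. -/
def conChain (g : G) : {H : Subgroup G} → (c : SubChain H) →
    (Tens R M N c.bot →ₗ[R] BoxGrade R M N (conj g H))
  | _, .base H => first R M N (conj g H) ∘ₗ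
      TensorProduct.map (gradeCon R M g H) (gradeCon R N g H)
  | _, .step h c => up R M N (conj_lt g h) ∘ₗ conChain g c

/-- `C_{g,H}` on the grade `H`. -/
def con (g : G) (H : Subgroup G) : BoxGrade R M N H →ₗ[R] BoxGrade R M N (conj g H) :=
  lift R M N fun c => conChain R M N g c

/-- `R^H_J` on the summands of the grade `H`: `R^H_J (m ⊗ n) = R^H_J m ⊗ R^H_J n` and
`R^H_J I^H_K x = ∑_{g ∈ [J\H/K]} I^J_{ᵍK ∩ J} C_g R^K_{K ∩ Jᵍ} x`. -/
def resChain : {H : Subgroup G} → (c : SubChain H) → (J : Subgroup G) → J ≤ H →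
    (Tens R M N c.bot →ₗ[R] BoxGrade R M N J)
  | _, .base _, J, hJ => first R M N J ∘ₗ
      TensorProduct.map (gradeRes R M hJ) (gradeRes R N hJ)
  | H, .step (K := K) _ c, J, _ => ∑ q : DCos J H K,
      ind R M N (conj_inf_le q.rep K J) ∘ₗ con R M N q.rep (K ⊓ conj q.rep⁻¹ J) ∘ₗ
        resChain c (K ⊓ conj q.rep⁻¹ J) inf_le_left

/-- `R^H_J` on the grade `H`. -/
def res {J H : Subgroup G} (h : J ≤ H) : BoxGrade R M N H →ₗ[R] BoxGrade R M N J :=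
  lift R M N fun c => resChain R M N c J h

end BoxGrade

/-- `A = ⨁_{H ≤ G} A_H`.  As `G` has finitely many subgroups, the direct sum is a product. -/
def BoxSum := ∀ H : Subgroup G, BoxGrade R M N H

instance : AddCommGroup (BoxSum (G := G) R M N) :=
  inferInstanceAs (AddCommGroup (∀ H : Subgroup G, BoxGrade R M N H))

instance : Module R (BoxSum (G := G) R M N) :=
  inferInstanceAs (Module R (∀ H : Subgroup G, BoxGrade R M N H))

open Classical in
/-- The inclusion of the grade `H` of `A`. -/
def BoxSum.inc (H : Subgroup G) : BoxGrade R M N H →ₗ[R] BoxSum (G := G) R M N :=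
  LinearMap.single R (fun H : Subgroup G => BoxGrade R M N H) H

/-- The projection to the grade `H` of `A`. -/
def BoxSum.pr (H : Subgroup G) : BoxSum (G := G) R M N →ₗ[R] BoxGrade R M N H :=
  LinearMap.proj H

/-- The operators `R^H_K`, `I^H_K` and `C_{g,H}` on `A`; they vanish on all grades but one. -/
def BoxSum.op : Gen G → Module.End R (BoxSum (G := G) R M N)
  | .res K H h => BoxSum.inc R M N K ∘ₗ BoxGrade.res R M N h ∘ₗ BoxSum.pr R M N H
  | .ind K H h => BoxSum.inc R M N H ∘ₗ BoxGrade.ind R M N h ∘ₗ BoxSum.pr R M N K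
  | .con g H => BoxSum.inc R M N (conj g H) ∘ₗ BoxGrade.con R M N g H ∘ₗ BoxSum.pr R M N H

/-- The action on `A` of the noncommutative polynomials in the symbols. -/
def BoxSum.act : FreeAlgebra R (Gen G) →ₐ[R] Module.End R (BoxSum (G := G) R M N) :=
  FreeAlgebra.lift R (BoxSum.op R M N)

/-- The Frobenius reciprocity elements `a ⊗ I^H_K b - I^H_K (R^H_K a ⊗ b)` and
`I^H_K c ⊗ d - I^H_K (c ⊗ R^H_K d)`, for `K < H`. -/
inductive BoxSum.IsFrob : BoxSum (G := G) R M N → Prop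
  | right {K H : Subgroup G} (h : K < H) (a : grade R M H) (b : grade R N K) : BoxSum.IsFrob
      (BoxSum.inc R M N H (BoxGrade.first R M N H (a ⊗ₜ gradeInd R N h.le b)) -
        BoxSum.op R M N (.ind K H h.le)
          (BoxSum.inc R M N K (BoxGrade.first R M N K (gradeRes R M h.le a ⊗ₜ b))))
  | left {K H : Subgroup G} (h : K < H) (c : grade R M K) (d : grade R N H) : BoxSum.IsFrob
      (BoxSum.inc R M N H (BoxGrade.first R M N H (gradeInd R M h.le c ⊗ₜ d)) -
        BoxSum.op R M N (.ind K H h.le)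
          (BoxSum.inc R M N K (BoxGrade.first R M N K (c ⊗ₜ gradeRes R N h.le d))))

/-- The Frobenius reciprocity submodule: the smallest submodule of `A` which contains the
Frobenius reciprocity elements and is stable under all `R^H_K`, `I^H_K`, `C_{g,H}`. -/
def BoxSum.FR : Submodule R (BoxSum (G := G) R M N) :=
  sInf {S | (∀ x, BoxSum.IsFrob R M N x → x ∈ S) ∧
    ∀ (s : Gen G) (x), x ∈ S → BoxSum.op R M N s x ∈ S}

/-- The submodule of `A` spanned by all `p · x` where `x ∈ A` and `p` is a relation between the
elements `R^H_K`, `I^H_K`, `C_{g,H}` of `μ_R(G)`.  The operators on `A` satisfy such a relation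
only modulo this submodule: for instance `C_{h,H} = I^H_H` in `μ_R(G)` for `h ∈ H`, but `C_{h,H}`
moves the summand `A_K` of `A_H` to the summand `A_{ʰK}`, and `I^H_K I^K_J = I^H_J`, but
`I^H_K I^K_J x` and `I^H_J x` lie in different summands of `A_H`. -/
def BoxSum.Rel : Submodule R (BoxSum (G := G) R M N) :=
  Submodule.span R {y | ∃ (p : FreeAlgebra R (Gen G)) (x : BoxSum (G := G) R M N),
    evalGen R G p = 0 ∧ BoxSum.act R M N p x = y}

theorem BoxSum.act_ι (s : Gen G) :
    BoxSum.act R M N (FreeAlgebra.ι R s) = BoxSum.op R M N s := by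
  simp [BoxSum.act]

theorem BoxSum.op_mem_FR (s : Gen G) {x : BoxSum (G := G) R M N} (hx : x ∈ BoxSum.FR R M N) :
    BoxSum.op R M N s x ∈ BoxSum.FR R M N := by
  rw [BoxSum.FR, Submodule.mem_sInf] at hx ⊢
  intro S hS
  exact hS.2 s x (hx S hS)

theorem BoxSum.op_mem_Rel (s : Gen G) {x : BoxSum (G := G) R M N} (hx : x ∈ BoxSum.Rel R M N) :
    BoxSum.op R M N s x ∈ BoxSum.Rel R M N := by
  have h : BoxSum.Rel R M N ≤ (BoxSum.Rel R M N).comap (BoxSum.op R M N s) := by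
    refine Submodule.span_le.2 ?_
    rintro y ⟨p, x, hp, rfl⟩
    refine Submodule.subset_span ⟨FreeAlgebra.ι R s * p, x, ?_, ?_⟩
    · rw [map_mul, hp, mul_zero]
    · rw [map_mul, BoxSum.act_ι]
      rfl
  exact h hx

/-- The submodule of `A` that is divided out. -/
def BoxSum.ker : Submodule R (BoxSum (G := G) R M N) := BoxSum.FR R M N ⊔ BoxSum.Rel R M N

theorem BoxSum.ker_le_comap (s : Gen G) :
    BoxSum.ker R M N ≤ (BoxSum.ker R M N).comap (BoxSum.op R M N s) :=
  sup_le (fun _ hx => Submodule.mem_sup_left (BoxSum.op_mem_FR R M N s hx))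
    (fun _ hx => Submodule.mem_sup_right (BoxSum.op_mem_Rel R M N s hx))

/-- The box product `M □ N` of left `μ_R(G)`-modules: the quotient of `A` by the Frobenius
reciprocity submodule `FR`, made a `μ_R(G)`-module by dividing out `Rel`. -/
def Box : Type _ := BoxSum (G := G) R M N ⧸ BoxSum.ker R M N

instance : AddCommGroup (Box (G := G) R M N) :=
  inferInstanceAs (AddCommGroup (BoxSum (G := G) R M N ⧸ BoxSum.ker R M N))

instance : Module R (Box (G := G) R M N) :=
  inferInstanceAs (Module R (BoxSum (G := G) R M N ⧸ BoxSum.ker R M N))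

/-- The quotient map `A → M □ N`. -/
def Box.mk : BoxSum (G := G) R M N →ₗ[R] Box (G := G) R M N := (BoxSum.ker R M N).mkQ

theorem Box.mk_surjective : Function.Surjective (Box.mk (G := G) R M N) :=
  Submodule.mkQ_surjective _

theorem Box.ker_mk : LinearMap.ker (Box.mk (G := G) R M N) = BoxSum.ker R M N :=
  Submodule.ker_mkQ _

/-- The operators on `M □ N` induced by those on `A`. -/
def Box.op (s : Gen G) : Module.End R (Box (G := G) R M N) :=
  (BoxSum.ker R M N).mapQ (BoxSum.ker R M N) (BoxSum.op R M N s) (BoxSum.ker_le_comap R M N s)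

theorem Box.op_mk (s : Gen G) (x : BoxSum (G := G) R M N) :
    Box.op R M N s (Box.mk R M N x) = Box.mk R M N (BoxSum.op R M N s x) := rfl

/-- The action on `M □ N` of the noncommutative polynomials in the symbols. -/
def Box.act : FreeAlgebra R (Gen G) →ₐ[R] Module.End R (Box (G := G) R M N) :=
  FreeAlgebra.lift R (Box.op R M N)

theorem Box.act_mk (p : FreeAlgebra R (Gen G)) (x : BoxSum (G := G) R M N) :
    Box.act R M N p (Box.mk R M N x) = Box.mk R M N (BoxSum.act R M N p x) := by
  induction p using FreeAlgebra.induction generalizing x with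
  | grade0 r => simp only [AlgHom.commutes, Module.algebraMap_end_apply, map_smul]
  | grade1 s => simp only [Box.act, BoxSum.act, FreeAlgebra.lift_ι_apply, Box.op_mk]
  | mul a b ha hb => simp only [map_mul, Module.End.mul_apply, ha, hb]
  | add a b ha hb => simp only [map_add, LinearMap.add_apply, ha, hb]

theorem Box.act_eq_zero (p : FreeAlgebra R (Gen G)) (hp : evalGen R G p = 0) :
    Box.act R M N p = 0 := by
  ext y
  obtain ⟨x, rfl⟩ := Box.mk_surjective R M N y
  rw [Box.act_mk]
  exact (Submodule.Quotient.mk_eq_zero _).2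
    (Submodule.mem_sup_right (Submodule.subset_span ⟨p, x, hp, rfl⟩))

/-- The action of the Mackey algebra on `M □ N`. -/
def Box.toEnd : MackeyAlgebra R G →+* Module.End R (Box (G := G) R M N) :=
  RingHom.liftOfSurjective (evalGen R G).toRingHom evalGen_surjective
    ⟨(Box.act R M N).toRingHom, fun p hp => Box.act_eq_zero R M N p hp⟩

theorem Box.toEnd_evalGen (p : FreeAlgebra R (Gen G)) :
    Box.toEnd R M N (evalGen R G p) = Box.act R M N p :=
  RingHom.liftOfRightInverse_comp_apply (evalGen R G).toRingHom _ _
    ⟨(Box.act R M N).toRingHom, fun p hp => Box.act_eq_zero R M N p hp⟩ p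

instance : Module (MackeyAlgebra R G) (Box (G := G) R M N) :=
  Module.compHom _ (Box.toEnd R M N)

theorem Box.evalGen_smul_mk (p : FreeAlgebra R (Gen G)) (x : BoxSum (G := G) R M N) :
    evalGen R G p • Box.mk R M N x = Box.mk R M N (BoxSum.act R M N p x) := by
  rw [← Box.act_mk, ← Box.toEnd_evalGen]
  rfl

/-- `R^H_K`, `I^H_K` and `C_{g,H}` act on `M □ N` through the operators on `A`. -/
theorem Box.elem_smul_mk (s : Gen G) (x : BoxSum (G := G) R M N) :
    s.elem R • Box.mk R M N x = Box.mk R M N (BoxSum.op R M N s x) := by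
  rw [← evalGen_ι, Box.evalGen_smul_mk, BoxSum.act_ι]

instance : IsScalarTower R (MackeyAlgebra R G) (Box (G := G) R M N) :=
  IsScalarTower.of_algebraMap_smul fun r y => by
    obtain ⟨x, rfl⟩ := Box.mk_surjective R M N y
    rw [← (evalGen R G).commutes, Box.evalGen_smul_mk, AlgHom.commutes,
      Module.algebraMap_end_apply, map_smul]

end Box

/-! ### Functoriality of the box product -/

section BoxMap

variable [Finite G] {M : Type*} [AddCommGroup M] [Module R M] [Module (MackeyAlgebra R G) M]
  [IsScalarTower R (MackeyAlgebra R G) M] {N : Type*} [AddCommGroup N] [Module R N]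
  [Module (MackeyAlgebra R G) N] [IsScalarTower R (MackeyAlgebra R G) N]
  {M' : Type*} [AddCommGroup M'] [Module R M'] [Module (MackeyAlgebra R G) M']
  [IsScalarTower R (MackeyAlgebra R G) M'] {N' : Type*} [AddCommGroup N'] [Module R N']
  [Module (MackeyAlgebra R G) N'] [IsScalarTower R (MackeyAlgebra R G) N']
  (f : M →ₗ[MackeyAlgebra R G] M') (g : N →ₗ[MackeyAlgebra R G] N')

theorem gradeMap_gradeMul {H K : Subgroup G} (a : orb R H ⟶ orb R K) (x : grade R M K) :
    gradeMap f H (gradeMul M a x) = gradeMul M' a (gradeMap f K x) :=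
  Subtype.ext (map_smul f (MackeyAlgebra.single H K a) (x : M))

/-- `f ⊗ g` on `I^H_H M ⊗ I^H_H N`. -/
def tensMap (H : Subgroup G) : Tens R M N H →ₗ[R] Tens R M' N' H :=
  TensorProduct.map (gradeMap f H) (gradeMap g H)

theorem tensMap_map {H K : Subgroup G} (a : orb R H ⟶ orb R K) (x : Tens R M N K) :
    tensMap f g H (TensorProduct.map (gradeMul M a) (gradeMul N a) x) =
      TensorProduct.map (gradeMul M' a) (gradeMul N' a) (tensMap f g K x) := by
  have h : tensMap f g H ∘ₗ TensorProduct.map (gradeMul M a) (gradeMul N a) =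
      TensorProduct.map (gradeMul M' a) (gradeMul N' a) ∘ₗ tensMap f g K := by
    refine TensorProduct.ext' fun m n => ?_
    simp [tensMap, gradeMap_gradeMul]
  exact LinearMap.congr_fun h x

/-- `f` and `g` induce a map on `A_H`, summand by summand. -/
def BoxGrade.map (H : Subgroup G) : BoxGrade R M N H →ₗ[R] BoxGrade R M' N' H :=
  BoxGrade.lift R M N fun c => BoxGrade.inc R M' N' c ∘ₗ tensMap f g c.bot

theorem BoxGrade.map_inc {H : Subgroup G} (c : SubChain H) (x : Tens R M N c.bot) :
    BoxGrade.map f g H (BoxGrade.inc R M N c x) =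
      BoxGrade.inc R M' N' c (tensMap f g c.bot x) :=
  BoxGrade.lift_inc R M N _ c x

theorem BoxGrade.map_first {H : Subgroup G} (x : Tens R M N H) :
    BoxGrade.map f g H (BoxGrade.first R M N H x) =
      BoxGrade.first R M' N' H (tensMap f g H x) :=
  BoxGrade.map_inc f g (SubChain.base H) x

theorem BoxGrade.map_up {K H : Subgroup G} (h : K < H) (x : BoxGrade R M N K) :
    BoxGrade.map f g H (BoxGrade.up R M N h x) =
      BoxGrade.up R M' N' h (BoxGrade.map f g K x) := by
  have e : BoxGrade.map f g H ∘ₗ BoxGrade.up R M N h =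
      BoxGrade.up R M' N' h ∘ₗ BoxGrade.map f g K := by
    refine BoxGrade.hom_ext R M N fun c x => ?_
    rw [LinearMap.comp_apply, LinearMap.comp_apply, BoxGrade.map_inc, BoxGrade.up_inc,
      BoxGrade.up_inc]
    exact BoxGrade.map_inc f g (SubChain.step h c) x
  exact LinearMap.congr_fun e x

theorem BoxGrade.map_ind {K H : Subgroup G} (h : K ≤ H) (x : BoxGrade R M N K) :
    BoxGrade.map f g H (BoxGrade.ind R M N h x) =
      BoxGrade.ind R M' N' h (BoxGrade.map f g K x) := by
  unfold BoxGrade.ind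
  by_cases e : K = H
  · subst e
    simp
  · simp only [e, dif_neg, not_false_eq_true]
    exact BoxGrade.map_up f g _ x

theorem BoxGrade.map_conChain (k : G) {H : Subgroup G} (c : SubChain H) (x : Tens R M N c.bot) :
    BoxGrade.map f g (conj k H) (BoxGrade.conChain R M N k c x) =
      BoxGrade.conChain R M' N' k c (tensMap f g c.bot x) := by
  induction c with
  | base H =>
    refine (BoxGrade.map_first f g _).trans ?_
    exact congrArg _ (tensMap_map f g _ x)
  | step h c ih =>
    refine (BoxGrade.map_up f g _ _).trans ?_
    exact congrArg _ (ih x)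

theorem BoxGrade.map_con (k : G) (H : Subgroup G) (x : BoxGrade R M N H) :
    BoxGrade.map f g (conj k H) (BoxGrade.con R M N k H x) =
      BoxGrade.con R M' N' k H (BoxGrade.map f g H x) := by
  have e : BoxGrade.map f g (conj k H) ∘ₗ BoxGrade.con R M N k H =
      BoxGrade.con R M' N' k H ∘ₗ BoxGrade.map f g H := by
    refine BoxGrade.hom_ext R M N fun c x => ?_
    rw [LinearMap.comp_apply, LinearMap.comp_apply, BoxGrade.map_inc, BoxGrade.con,
      BoxGrade.con, BoxGrade.lift_inc, BoxGrade.lift_inc, BoxGrade.map_conChain]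
  exact LinearMap.congr_fun e x

theorem BoxGrade.map_resChain {H : Subgroup G} (c : SubChain H) (J : Subgroup G) (hJ : J ≤ H)
    (x : Tens R M N c.bot) :
    BoxGrade.map f g J (BoxGrade.resChain R M N c J hJ x) =
      BoxGrade.resChain R M' N' c J hJ (tensMap f g c.bot x) := by
  induction c generalizing J with
  | base H =>
    refine (BoxGrade.map_first f g _).trans ?_
    exact congrArg _ (tensMap_map f g _ x)
  | step h c ih =>
    simp only [BoxGrade.resChain]
    rw [LinearMap.sum_apply, LinearMap.sum_apply, map_sum]
    refine Finset.sum_congr rfl fun q _ => ?_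
    refine (BoxGrade.map_ind f g _ _).trans ?_
    refine congrArg _ ((BoxGrade.map_con f g _ _ _).trans ?_)
    exact congrArg _ (ih _ _ x)

theorem BoxGrade.map_res {J H : Subgroup G} (h : J ≤ H) (x : BoxGrade R M N H) :
    BoxGrade.map f g J (BoxGrade.res R M N h x) =
      BoxGrade.res R M' N' h (BoxGrade.map f g H x) := by
  have e : BoxGrade.map f g J ∘ₗ BoxGrade.res R M N h =
      BoxGrade.res R M' N' h ∘ₗ BoxGrade.map f g H := by
    refine BoxGrade.hom_ext R M N fun c x => ?_
    rw [LinearMap.comp_apply, LinearMap.comp_apply, BoxGrade.map_inc, BoxGrade.res,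
      BoxGrade.res, BoxGrade.lift_inc, BoxGrade.lift_inc, BoxGrade.map_resChain]
  exact LinearMap.congr_fun e x

/-- `f` and `g` induce a map on `A`, grade by grade. -/
def BoxSum.map : BoxSum (G := G) R M N →ₗ[R] BoxSum (G := G) R M' N' :=
  LinearMap.pi (φ := fun H : Subgroup G => BoxGrade R M' N' H)
    fun H => BoxGrade.map f g H ∘ₗ BoxSum.pr R M N H

theorem BoxSum.map_inc (H : Subgroup G) (x : BoxGrade R M N H) :
    BoxSum.map f g (BoxSum.inc R M N H x) = BoxSum.inc R M' N' H (BoxGrade.map f g H x) := by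
  classical
  refine funext fun K => ?_
  change BoxGrade.map f g K (Pi.single H x K : BoxGrade R M N K) =
    (Pi.single H (BoxGrade.map f g H x) K : BoxGrade R M' N' K)
  by_cases h : K = H
  · subst h
    simp
  · simp [h]

theorem BoxSum.map_op (s : Gen G) (x : BoxSum (G := G) R M N) :
    BoxSum.map f g (BoxSum.op R M N s x) = BoxSum.op R M' N' s (BoxSum.map f g x) := by
  cases s with
  | res K H h =>
    refine (BoxSum.map_inc f g K _).trans ?_
    exact congrArg _ (BoxGrade.map_res f g h _)
  | ind K H h =>
    refine (BoxSum.map_inc f g H _).trans ?_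
    exact congrArg _ (BoxGrade.map_ind f g h _)
  | con k H =>
    refine (BoxSum.map_inc f g _ _).trans ?_
    exact congrArg _ (BoxGrade.map_con f g k H _)

theorem BoxSum.map_act (p : FreeAlgebra R (Gen G)) (x : BoxSum (G := G) R M N) :
    BoxSum.map f g (BoxSum.act R M N p x) = BoxSum.act R M' N' p (BoxSum.map f g x) := by
  induction p using FreeAlgebra.induction generalizing x with
  | grade0 r => simp only [AlgHom.commutes, Module.algebraMap_end_apply, map_smul]
  | grade1 s => rw [BoxSum.act_ι, BoxSum.act_ι, BoxSum.map_op]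
  | mul a b ha hb => simp only [map_mul, Module.End.mul_apply, ha, hb]
  | add a b ha hb => simp only [map_add, LinearMap.add_apply, ha, hb]

theorem BoxSum.frob_mem_FR {x : BoxSum (G := G) R M N} (hx : BoxSum.IsFrob R M N x) :
    x ∈ BoxSum.FR R M N := by
  rw [BoxSum.FR, Submodule.mem_sInf]
  exact fun S hS => hS.1 x hx

theorem BoxSum.map_frob {x : BoxSum (G := G) R M N} (hx : BoxSum.IsFrob R M N x) :
    BoxSum.IsFrob R M' N' (BoxSum.map f g x) := by
  cases hx with
  | right h a b =>
    rw [map_sub, BoxSum.map_op, BoxSum.map_inc, BoxSum.map_inc, BoxGrade.map_first,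
      BoxGrade.map_first]
    have h1 := BoxSum.IsFrob.right (R := R) h (gradeMap f _ a) (gradeMap g _ b)
    rw [gradeInd, gradeRes, ← gradeMap_gradeMul, ← gradeMap_gradeMul] at h1
    exact h1
  | left h a b =>
    rw [map_sub, BoxSum.map_op, BoxSum.map_inc, BoxSum.map_inc, BoxGrade.map_first,
      BoxGrade.map_first]
    have h1 := BoxSum.IsFrob.left (R := R) h (gradeMap f _ a) (gradeMap g _ b)
    rw [gradeInd, gradeRes, ← gradeMap_gradeMul, ← gradeMap_gradeMul] at h1
    exact h1

theorem BoxSum.ker_le_comap_map :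
    BoxSum.ker R M N ≤ (BoxSum.ker (G := G) R M' N').comap (BoxSum.map f g) := by
  refine sup_le ?_ ?_
  · refine sInf_le ⟨fun x hx => Submodule.mem_sup_left
      (BoxSum.frob_mem_FR (BoxSum.map_frob f g hx)), fun s x hx => ?_⟩
    rw [Submodule.mem_comap, BoxSum.map_op]
    exact BoxSum.ker_le_comap R M' N' s hx
  · refine Submodule.span_le.2 ?_
    rintro y ⟨p, x, hp, rfl⟩
    exact Submodule.mem_sup_right (Submodule.subset_span ⟨p, _, hp, (BoxSum.map_act f g p x).symm⟩)

/-- The `R`-linear map underlying `Box.map`. -/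
def Box.mapAux : Box (G := G) R M N →ₗ[R] Box (G := G) R M' N' :=
  (BoxSum.ker R M N).mapQ (BoxSum.ker R M' N') (BoxSum.map f g) (BoxSum.ker_le_comap_map f g)

theorem Box.mapAux_mk (x : BoxSum (G := G) R M N) :
    Box.mapAux f g (Box.mk R M N x) = Box.mk R M' N' (BoxSum.map f g x) := rfl

/-- The map `f □ g : M □ N → M' □ N'` induced by `μ_R(G)`-module maps `f` and `g`. -/
def Box.map : Box (G := G) R M N →ₗ[MackeyAlgebra R G] Box (G := G) R M' N' where
  toFun := Box.mapAux f g
  map_add' := map_add _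
  map_smul' a y := by
    obtain ⟨p, rfl⟩ := evalGen_surjective a
    obtain ⟨x, rfl⟩ := Box.mk_surjective R M N y
    rw [Box.evalGen_smul_mk, Box.mapAux_mk, Box.mapAux_mk, BoxSum.map_act, RingHom.id_apply,
      Box.evalGen_smul_mk]

end BoxMap

/-! ### Mackey functors, Dress pairings, and the functor `Φ` -/

/-- A Mackey functor: an `R`-additive functor `Ω_R(G)ᵒᵖ → R`-mod. -/
structure MackeyFunctor (R : Type w) [CommRing R] (G : Type u) [Group G] where
  /-- the underlying functor -/
  F : (Omega R G)ᵒᵖ ⥤ ModuleCat.{v} R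
  map_add : ∀ {X Y : Omega R G} (f g : X ⟶ Y), F.map (f + g).op = F.map f.op + F.map g.op
  map_smul : ∀ {X Y : Omega R G} (r : R) (f : X ⟶ Y), F.map (r • f).op = r • F.map f.op

namespace MackeyFunctor

variable (M : MackeyFunctor.{u, v, w} R G)

/-- The value `M(X)` at a finite `G`-set `X`. -/
abbrev val (X : Omega R G) : ModuleCat.{v} R := M.F.obj (op X)

/-- The map `M(Y) → M(X)` given by a morphism `X ⟶ Y` of `Ω_R(G)`. -/
def ap {X Y : Omega R G} (f : X ⟶ Y) : M.val Y →ₗ[R] M.val X := (M.F.map f.op).hom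

/-- The restriction `r_f : M(Y) → M(X)` of a map `f : X → Y` of `G`-sets. -/
def r {X Y : Omega R G} (f : X.gset →[G] Y.gset) : M.val Y →ₗ[R] M.val X := M.ap (Omega.res f)

/-- The transfer `t_f : M(X) → M(Y)` of a map `f : X → Y` of `G`-sets. -/
def t {X Y : Omega R G} (f : X.gset →[G] Y.gset) : M.val X →ₗ[R] M.val Y := M.ap (Omega.tr f)

/-- Morphisms of Mackey functors are natural transformations. -/
abbrev Hom (M N : MackeyFunctor.{u, v, w} R G) := M.F ⟶ N.F

/-- The component at `X` of a morphism of Mackey functors. -/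
def Hom.at {M N : MackeyFunctor.{u, v, w} R G} (φ : M.Hom N) (X : Omega R G) :
    M.val X →ₗ[R] N.val X := (φ.app (op X)).hom

theorem Hom.at_ap {M N : MackeyFunctor.{u, v, w} R G} (φ : M.Hom N) {X Y : Omega R G}
    (f : X ⟶ Y) (x : M.val Y) : φ.at X (M.ap f x) = N.ap f (φ.at Y x) :=
  LinearMap.congr_fun (congrArg ModuleCat.Hom.hom (φ.naturality f.op)) x

theorem ap_id (X : Omega R G) (x : M.val X) : M.ap (𝟙 X) x = x :=
  LinearMap.congr_fun (congrArg ModuleCat.Hom.hom (M.F.map_id (op X))) x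

theorem ap_comp {X Y Z : Omega R G} (f : X ⟶ Y) (g : Y ⟶ Z) (x : M.val Z) :
    M.ap (f ≫ g) x = M.ap f (M.ap g x) :=
  LinearMap.congr_fun (congrArg ModuleCat.Hom.hom (M.F.map_comp g.op f.op)) x

theorem ap_add {X Y : Omega R G} (f g : X ⟶ Y) (x : M.val Y) :
    M.ap (f + g) x = M.ap f x + M.ap g x :=
  LinearMap.congr_fun (congrArg ModuleCat.Hom.hom (M.map_add f g)) x

theorem ap_smul {X Y : Omega R G} (r : R) (f : X ⟶ Y) (x : M.val Y) :
    M.ap (r • f) x = r • M.ap f x :=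
  LinearMap.congr_fun (congrArg ModuleCat.Hom.hom (M.map_smul r f)) x

theorem ap_zero {X Y : Omega R G} (x : M.val Y) : M.ap (0 : X ⟶ Y) x = 0 := by
  have h := M.ap_smul (0 : R) (0 : X ⟶ Y) x
  rwa [zero_smul, zero_smul] at h

theorem ap_sum {X Y : Omega R G} {ι : Type*} (s : Finset ι) (f : ι → (X ⟶ Y)) (x : M.val Y) :
    M.ap (∑ i ∈ s, f i) x = ∑ i ∈ s, M.ap (f i) x := by
  classical
  induction s using Finset.induction_on with
  | empty => simp [ap_zero]
  | insert i s hi ih => rw [Finset.sum_insert hi, Finset.sum_insert hi, ap_add, ih]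

end MackeyFunctor

/-- A Dress pairing from `M` and `N` to `P`. -/
@[ext] structure DressPairing (M N P : MackeyFunctor.{u, v, w} R G) where
  /-- the maps `θ_X : M(X) ⊗ N(X) → P(X)` -/
  θ : ∀ X : Omega R G, M.val X ⊗[R] N.val X →ₗ[R] P.val X
  res : ∀ {X Y : Omega R G} (f : X.gset →[G] Y.gset) (m : M.val Y) (n : N.val Y),
    P.r f (θ Y (m ⊗ₜ n)) = θ X (M.r f m ⊗ₜ N.r f n)
  frob_left : ∀ {X Y : Omega R G} (f : X.gset →[G] Y.gset) (m : M.val X) (n : N.val Y),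
    P.t f (θ X (m ⊗ₜ N.r f n)) = θ Y (M.t f m ⊗ₜ n)
  frob_right : ∀ {X Y : Omega R G} (f : X.gset →[G] Y.gset) (m : M.val Y) (n : N.val X),
    P.t f (θ X (M.r f m ⊗ₜ n)) = θ Y (m ⊗ₜ N.t f n)

/-- Functoriality of Dress pairings: contravariant in `M` and `N`, covariant in `P`. -/
def DressPairing.map {M M' N N' P P' : MackeyFunctor.{u, v, w} R G} (a : M'.Hom M)
    (b : N'.Hom N) (c : P.Hom P') (θ : DressPairing M N P) : DressPairing M' N' P' where
  θ X := c.at X ∘ₗ θ.θ X ∘ₗ TensorProduct.map (a.at X) (b.at X)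
  res f m n := by
    have h := congrArg (c.at _) (θ.res f (a.at _ m) (b.at _ n))
    simp only [MackeyFunctor.r, MackeyFunctor.Hom.at_ap] at h
    simpa [MackeyFunctor.r, MackeyFunctor.Hom.at_ap] using h
  frob_left f m n := by
    have h := congrArg (c.at _) (θ.frob_left f (a.at _ m) (b.at _ n))
    simp only [MackeyFunctor.r, MackeyFunctor.t, MackeyFunctor.Hom.at_ap] at h
    simpa [MackeyFunctor.r, MackeyFunctor.t, MackeyFunctor.Hom.at_ap] using h
  frob_right f m n := by
    have h := congrArg (c.at _) (θ.frob_right f (a.at _ m) (b.at _ n))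
    simp only [MackeyFunctor.r, MackeyFunctor.t, MackeyFunctor.Hom.at_ap] at h
    simpa [MackeyFunctor.r, MackeyFunctor.t, MackeyFunctor.Hom.at_ap] using h

section Phi

variable [Finite G]

/-- `Φ M = ⨁_{H ≤ G} M(G/H)`.  As `G` has finitely many subgroups, the direct sum is a product. -/
def Phi (M : MackeyFunctor.{u, v, w} R G) : Type (max u v) :=
  ∀ H : Subgroup G, M.val (orb R H)

variable (M N P : MackeyFunctor.{u, v, w} R G)

instance : AddCommGroup (Phi M) :=
  inferInstanceAs (AddCommGroup (∀ H : Subgroup G, M.val (orb R H)))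

instance : Module R (Phi M) :=
  inferInstanceAs (Module R (∀ H : Subgroup G, M.val (orb R H)))

/-- A morphism `a : G/H → G/K` in `μ_R(G)` acts by `M(a) : M(G/K) → M(G/H)` on the grade `K` and
by zero on the other grades. -/
instance : SMul (MackeyAlgebra R G) (Phi M) := ⟨fun a x H => ∑ K, M.ap (a H K) (x K)⟩

theorem Phi.smul_app (a : MackeyAlgebra R G) (x : Phi M) (H : Subgroup G) :
    (a • x) H = ∑ K, M.ap (a H K) (x K) := rfl

theorem Phi.add_app (x y : Phi M) (H : Subgroup G) : (x + y) H = x H + y H := rfl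

theorem Phi.zero_app (H : Subgroup G) : (0 : Phi M) H = 0 := rfl

theorem Phi.rsmul_app (r : R) (x : Phi M) (H : Subgroup G) : (r • x) H = r • x H := rfl

instance : Module (MackeyAlgebra R G) (Phi M) where
  one_smul x := by
    refine funext fun H => ?_
    rw [Phi.smul_app, Finset.sum_eq_single H, MackeyAlgebra.one_app_same, M.ap_id]
    · intro K _ hK
      rw [MackeyAlgebra.one_app_ne (Ne.symm hK), M.ap_zero]
    · simp
  mul_smul a b x := by
    refine funext fun H => ?_
    simp only [Phi.smul_app, MackeyAlgebra.mul_app, M.ap_sum, M.ap_comp, map_sum]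
    exact Finset.sum_comm
  smul_zero a := by
    refine funext fun H => ?_
    simp [Phi.smul_app, Phi.zero_app]
  smul_add a x y := by
    refine funext fun H => ?_
    simp [Phi.smul_app, Phi.add_app, Finset.sum_add_distrib]
  add_smul a b x := by
    refine funext fun H => ?_
    simp [Phi.smul_app, Phi.add_app, M.ap_add, Finset.sum_add_distrib]
  zero_smul x := by
    refine funext fun H => ?_
    simp [Phi.smul_app, Phi.zero_app, M.ap_zero]

instance : IsScalarTower R (MackeyAlgebra R G) (Phi M) where
  smul_assoc r a x := by
    refine funext fun H => ?_
    simp [Phi.smul_app, Phi.rsmul_app, M.ap_smul, Finset.smul_sum]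

variable {M N} in
/-- `Φ` on morphisms. -/
def Phi.map (φ : M.Hom N) : Phi M →ₗ[MackeyAlgebra R G] Phi N where
  toFun x H := φ.at (orb R H) (x H)
  map_add' x y := by
    refine funext fun H => ?_
    exact LinearMap.map_add _ _ _
  map_smul' a x := by
    refine funext fun H => ?_
    change φ.at (orb R H) (∑ K, M.ap (a H K) (x K)) = ∑ K, N.ap (a H K) (φ.at (orb R K) (x K))
    simp [MackeyFunctor.Hom.at_ap]

open Classical in
/-- The inclusion of `M(G/H)` in `Φ M`. -/
def Phi.inc (H : Subgroup G) : M.val (orb R H) →ₗ[R] Phi M :=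
  LinearMap.single R (fun H : Subgroup G => M.val (orb R H)) H

theorem Phi.inc_same (H : Subgroup G) (m : M.val (orb R H)) : Phi.inc M H m H = m := by
  classical
  exact Pi.single_eq_same (M := fun H : Subgroup G => M.val (orb R H)) H m

theorem Phi.inc_ne {H K : Subgroup G} (h : K ≠ H) (m : M.val (orb R H)) :
    Phi.inc M H m K = 0 := by
  classical
  exact Pi.single_eq_of_ne (M := fun H : Subgroup G => M.val (orb R H)) h m

theorem Phi.single_smul {H K : Subgroup G} (f : orb R H ⟶ orb R K) (x : Phi M) :
    MackeyAlgebra.single H K f • x = Phi.inc M H (M.ap f (x K)) := by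
  refine funext fun J => ?_
  rw [Phi.smul_app, Finset.sum_eq_single K]
  · by_cases hJ : J = H
    · subst hJ
      rw [MackeyAlgebra.single_same, Phi.inc_same]
    · rw [MackeyAlgebra.single_of_ne_left _ hJ, M.ap_zero, Phi.inc_ne M hJ]
  · intro L _ hL
    rw [MackeyAlgebra.single_of_ne_right _ hL, M.ap_zero]
  · simp

/-- The identification `M(G/H) = I^H_H Φ M`. -/
def Phi.gr (H : Subgroup G) : M.val (orb R H) ≃ₗ[R] grade R (Phi M) H :=
  LinearEquiv.ofLinearMap
    ((Phi.inc M H).codRestrict _ fun m => mem_grade.2 (by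
      rw [MackeyAlgebra.indEl_self, Phi.single_smul, M.ap_id, Phi.inc_same]))
    (LinearMap.proj (φ := fun H : Subgroup G => M.val (orb R H)) H ∘ₗ
      (grade R (Phi M) H).subtype)
    (LinearMap.ext fun x => Subtype.ext (by
      have h := mem_grade.1 x.2
      rw [MackeyAlgebra.indEl_self, Phi.single_smul, M.ap_id] at h
      exact h))
    (LinearMap.ext fun m => Phi.inc_same M H m)

theorem Phi.coe_gr (H : Subgroup G) (m : M.val (orb R H)) :
    (Phi.gr M H m : Phi M) = Phi.inc M H m := rfl

/-- The class in `Φ M □ Φ N` of the element `m ⊗ n` of the first summand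
`M(G/H) ⊗ N(G/H)` of the grade `H`. -/
def firstTensor (H : Subgroup G) (m : M.val (orb R H)) (n : N.val (orb R H)) :
    Box (G := G) R (Phi M) (Phi N) :=
  Box.mk R (Phi M) (Phi N) (BoxSum.inc R (Phi M) (Phi N) H
    (BoxGrade.first R (Phi M) (Phi N) H (Phi.gr M H m ⊗ₜ[R] Phi.gr N H n)))

end Phi

end MackeyBox

end

open MackeyBox

noncomputable section

namespace MackeyBox

variable {R : Type w} [CommRing R] {G : Type u} [Group G]

/-! ### Relations between restrictions and transfers -/

theorem Omega.res_comp_res {X Y Z : Omega R G} (f : X.gset →[G] Y.gset)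
    (g : Y.gset →[G] Z.gset) :
    (Omega.res f : X ⟶ Y) ≫ Omega.res g = Omega.res (g.comp f) := by
  unfold Omega.res
  rw [Omega.span_comp]
  exact Omega.span_eq ⟨⟨fun p => p.1.1, fun x => ⟨(x, f x), rfl⟩,
    fun p => Subtype.ext (Prod.ext rfl p.2), fun _ => rfl⟩, fun _ _ => rfl,
    fun _ => rfl, fun p => congrArg g p.2⟩

theorem Omega.span_eq_zero {X Y : Omega R G} (S : GSpan X.gset Y.gset) (hS : IsEmpty S.apex) :
    (Omega.span S : X ⟶ Y) = 0 := by
  refine (Omega.span_eq (T := GSpan.zero X.gset Y.gset) ?_).trans (Omega.span_zero X Y)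
  exact ⟨⟨fun x => (hS.false x).elim, fun x => PEmpty.elim x, fun x => (hS.false x).elim,
    fun x => PEmpty.elim x⟩, fun _ x => (hS.false x).elim, fun x => (hS.false x).elim,
    fun x => (hS.false x).elim⟩

theorem Omega.res_comp_tr_of_disjoint {X Y Z : Omega R G} (f : X.gset →[G] Z.gset)
    (g : Y.gset →[G] Z.gset) (h : ∀ x y, f x ≠ g y) :
    (Omega.res f : X ⟶ Z) ≫ Omega.tr g = 0 := by
  unfold Omega.res Omega.tr
  rw [Omega.span_comp]
  exact Omega.span_eq_zero _ ⟨fun p => h _ _ p.2⟩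

theorem Omega.res_comp_tr_self {X Y : Omega R G} (f : X.gset →[G] Y.gset)
    (hf : Function.Injective f) : (Omega.res f : X ⟶ Y) ≫ Omega.tr f = 𝟙 X := by
  unfold Omega.res Omega.tr
  rw [Omega.span_comp]
  refine (Omega.span_eq (T := ⟨X.gset, MulActionHom.id G, MulActionHom.id G⟩) ?_).trans rfl
  exact ⟨⟨fun p => p.1.1, fun x => ⟨(x, x), rfl⟩,
    fun p => Subtype.ext (Prod.ext rfl (hf p.2)), fun _ => rfl⟩, fun _ _ => rfl,
    fun _ => rfl, fun p => hf p.2⟩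

/-- A span whose middle term is the disjoint union of the images of injective `G`-maps `j i` is
the sum of the spans obtained by composition with the `j i`. -/
theorem Omega.span_eq_sum {X Y : Omega R G} (S : GSpan X.gset Y.gset) {ι : Type*} [Fintype ι]
    (V : ι → FinGSet G) (j : ∀ i, V i →[G] S.apex)
    (hinj : ∀ i, Function.Injective (j i))
    (hdisj : ∀ i i' x x', j i x = j i' x' → i = i')
    (hsurj : ∀ v, ∃ i x, j i x = v) :
    (Omega.span S : X ⟶ Y) = ∑ i, Omega.span ⟨V i, S.left.comp (j i), S.right.comp (j i)⟩ := by
  classical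
  have hp : ∀ (s : Finset ι) (g : G) v, (∃ i ∈ s, ∃ x, j i x = v) →
      ∃ i ∈ s, ∃ x, j i x = g • v := by
    rintro s g v ⟨i, hi, x, rfl⟩
    exact ⟨i, hi, g • x, map_smul _ _ _⟩
  have key : ∀ s : Finset ι, (Omega.span (S.restrict _ (hp s)) : X ⟶ Y) =
      ∑ i ∈ s, Omega.span ⟨V i, S.left.comp (j i), S.right.comp (j i)⟩ := by
    intro s
    induction s using Finset.induction_on with
    | empty =>
      rw [Finset.sum_empty]
      exact Omega.span_eq_zero _ ⟨fun v => by
        obtain ⟨_, i, hi, _⟩ := v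
        simp at hi⟩
    | insert i s hi ih =>
      rw [Finset.sum_insert hi, ← ih, ← Omega.span_add]
      let φ : (V i : Type u) ⊕ {v : S.apex // ∃ i ∈ s, ∃ x, j i x = v} →
          {v : S.apex // ∃ i' ∈ insert i s, ∃ x, j i' x = v} :=
        Sum.elim (fun x => ⟨j i x, i, Finset.mem_insert_self i s, x, rfl⟩) fun v => ⟨v.1, by
          obtain ⟨i', hi', h⟩ := v.2
          exact ⟨i', Finset.mem_insert_of_mem hi', h⟩⟩
      refine (Omega.span_eq ⟨Equiv.ofBijective φ ⟨?_, ?_⟩, ?_, ?_, ?_⟩).symm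
      · rintro (x | ⟨_, a, ha, x, rfl⟩) (y | ⟨_, b, hb, y, rfl⟩) h
        · exact congrArg Sum.inl (hinj i (congrArg Subtype.val h))
        · exact (hi (hdisj _ _ _ _ (congrArg Subtype.val h) ▸ hb)).elim
        · exact (hi (hdisj _ _ _ _ (congrArg Subtype.val h) ▸ ha)).elim
        · have e := congrArg Subtype.val h
          exact congrArg Sum.inr (Subtype.ext e)
      · rintro ⟨_, a, ha, x, rfl⟩
        rcases Finset.mem_insert.1 ha with rfl | ha
        · exact ⟨Sum.inl x, rfl⟩
        · exact ⟨Sum.inr ⟨_, a, ha, x, rfl⟩, rfl⟩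
      · rintro g (x | x)
        · exact Subtype.ext (map_smul (j i) g x)
        · rfl
      · rintro (x | x) <;> rfl
      · rintro (x | x) <;> rfl
  rw [← key]
  refine (Omega.span_eq ⟨Equiv.subtypeUnivEquiv fun v => ?_, ?_, ?_, ?_⟩).symm
  · obtain ⟨i, x, h⟩ := hsurj v
    exact ⟨i, Finset.mem_univ i, x, h⟩
  · intro _ _; rfl
  · intro _; rfl
  · intro _; rfl

theorem Omega.tr_comp_res_self {X Y : Omega R G} (f : X.gset →[G] Y.gset)
    (hf : Function.Bijective f) : (Omega.tr f : Y ⟶ X) ≫ Omega.res f = 𝟙 Y := by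
  rw [Omega.tr_comp_res]
  refine (Omega.span_eq (T := ⟨Y.gset, MulActionHom.id G, MulActionHom.id G⟩) ?_).trans rfl
  exact ⟨Equiv.ofBijective f hf, fun g v => map_smul f g v, fun _ => rfl, fun _ => rfl⟩

theorem DCos.rep_mem {J H K : Subgroup G} (q : DCos J H K) : q.rep ∈ H :=
  (Quotient.out q : H).2

theorem DCos.eq_of_rep {J H K : Subgroup G} {q q' : DCos J H K} {a b : G} (ha : a ∈ J)
    (hb : b ∈ K) (hJ : J ≤ H) (hK : K ≤ H) (h : q'.rep = a * q.rep * b) : q = q' := by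
  rw [← Quotient.out_eq q, ← Quotient.out_eq q']
  refine Quotient.sound (DoubleCoset.rel_iff.2 ⟨⟨a, hJ ha⟩, ha, ⟨b, hK hb⟩, hb, ?_⟩)
  exact Subtype.ext h

theorem DCos.exists_rep {J H K : Subgroup G} {h : G} (hh : h ∈ H) :
    ∃ q : DCos J H K, ∃ a ∈ J, ∃ b ∈ K, q.rep = a * h * b := by
  let q : DCos J H K := Quotient.mk _ ⟨h, hh⟩
  have e : (DoubleCoset.setoid (J.subgroupOf H : Set H) (K.subgroupOf H : Set H)) ⟨h, hh⟩
      (Quotient.out q) := Quotient.exact (Quotient.out_eq q).symm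
  obtain ⟨a, ha, b, hb, e⟩ := DoubleCoset.rel_iff.1 e
  exact ⟨q, a, ha, b, hb, congrArg Subtype.val e⟩

/-! ### The decomposition of a `G`-set into orbits -/

section Finite

variable [Finite G]

/-- The `G`-map `G/G_x → X` with `1 ↦ x`. -/
def stabMap (X : FinGSet G) (x : X) : orbit (MulAction.stabilizer G x) →[G] X where
  toFun := MulAction.ofQuotientStabilizer G x
  map_smul' g v := by
    induction v using Quotient.inductionOn' with | h k =>
    exact mul_smul g k x

theorem stabMap_injective (X : FinGSet G) (x : X) : Function.Injective (stabMap X x) :=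
  MulAction.injective_ofQuotientStabilizer G x

/-- The orbits of a `G`-set. -/
abbrev Orbits (X : FinGSet G) : Type u := MulAction.orbitRel.Quotient G X

instance (X : FinGSet G) : Fintype (Orbits X) :=
  haveI : Finite (Orbits X) := Quotient.finite _
  Fintype.ofFinite _

/-- The orbit of a point. -/
def Orbits.of {X : FinGSet G} (x : X) : Orbits X := Quotient.mk _ x

/-- The stabilizer of the chosen representative of an orbit. -/
def Orbits.stab {X : FinGSet G} (ω : Orbits X) : Subgroup G :=
  MulAction.stabilizer G (Quotient.out ω : X)

/-- The isomorphism of some `G/H` with an orbit of `X`, as a map to `X`. -/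
def Orbits.inj {X : FinGSet G} (ω : Orbits X) : orbit ω.stab →[G] X := stabMap X (Quotient.out ω)

theorem Orbits.inj_injective {X : FinGSet G} (ω : Orbits X) : Function.Injective ω.inj :=
  stabMap_injective X _

theorem Orbits.mk_inj {X : FinGSet G} (ω : Orbits X) (v : orbit ω.stab) :
    Orbits.of (ω.inj v) = ω := by
  induction v using Quotient.inductionOn' with | h k =>
  refine Eq.trans ?_ (Quotient.out_eq ω)
  exact Quotient.sound ⟨k, rfl⟩

theorem Orbits.exists_inj_eq {X : FinGSet G} (x : X) :
    ∃ v, (Orbits.of x).inj v = x := by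
  obtain ⟨k, hk⟩ : (MulAction.orbitRel G X) x (Quotient.out (Orbits.of x)) :=
    Quotient.exact (Quotient.out_eq (Orbits.of x)).symm
  exact ⟨(k : G ⧸ _), hk⟩

/-- The coset `kH` as a point of the `G`-set `G/H`. -/
def orbitMk (H : Subgroup G) (k : G) : orbit H := (k : G ⧸ H)

theorem orbitMk_eq {H : Subgroup G} {a b : G} : orbitMk H a = orbitMk H b ↔ a⁻¹ * b ∈ H :=
  QuotientGroup.eq

theorem smul_orbitMk (H : Subgroup G) (g k : G) : g • orbitMk H k = orbitMk H (g * k) := rfl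

theorem orbit_exists_smul_one {H : Subgroup G} (v : orbit H) :
    ∃ k : G, k • orbitMk H 1 = v := by
  induction v using Quotient.inductionOn' with | h k =>
  exact ⟨k, congrArg (orbitMk H) (mul_one k)⟩

/-- A `G`-map from a transitive `G`-set factors through an orbit. -/
theorem Orbits.exists_factor {X : FinGSet G} {K : Subgroup G} (f : orbit K →[G] X) :
    ∃ (ω : Orbits X) (f' : orbit K →[G] orbit ω.stab), f = ω.inj.comp f' := by
  set x : X := f (orbitMk K 1) with hx
  have h : ∀ v : orbit K, ∃ w, (Orbits.of x).inj w = f v := by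
    intro v
    obtain ⟨k, rfl⟩ := orbit_exists_smul_one v
    obtain ⟨w, hw⟩ := Orbits.exists_inj_eq x
    exact ⟨k • w, by rw [map_smul, map_smul, hw]⟩
  choose f' hf' using h
  refine ⟨Orbits.of x, ⟨f', fun g v => Orbits.inj_injective _ ?_⟩, ?_⟩
  · rw [map_smul, hf', hf']
    exact map_smul f g v
  · ext v
    exact (hf' v).symm

theorem Omega.id_eq_sum (X : Omega R G) : 𝟙 X = ∑ ω : Orbits X.gset,
    Omega.tr (X := orb R ω.stab) ω.inj ≫ Omega.res (X := orb R ω.stab) ω.inj := by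
  refine Eq.trans (Omega.span_eq_sum (X := X) (Y := X)
    ⟨X.gset, MulActionHom.id G, MulActionHom.id G⟩ (fun ω : Orbits X.gset => orbit ω.stab)
    (fun ω => ω.inj) (fun ω => ω.inj_injective) ?_ ?_) ?_
  · intro ω ω' v v' h
    rw [← ω.mk_inj v, h, ω'.mk_inj]
  · exact fun x => ⟨Orbits.of (X := X.gset) x, Orbits.exists_inj_eq (X := X.gset) x⟩
  · refine Finset.sum_congr rfl fun ω _ => ?_
    rw [Omega.tr_comp_res]
    rfl

theorem Orbits.res_comp_tr_of_ne {X : Omega R G} {ω ω' : Orbits X.gset} (h : ω ≠ ω') :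
    Omega.res (X := orb R ω.stab) (Y := X) ω.inj ≫ Omega.tr (X := orb R ω'.stab) ω'.inj = 0 :=
  Omega.res_comp_tr_of_disjoint _ _ fun v v' e => h (by rw [← ω.mk_inj v, e, ω'.mk_inj])

/-! ### Maps between transitive `G`-sets -/

theorem cmap_bijective (g : G) (H : Subgroup G) : Function.Bijective (cmap g H) := by
  constructor
  · intro x y
    induction x using Quotient.inductionOn' with | h a =>
    induction y using Quotient.inductionOn' with | h b =>
    intro h
    have h' : ((a * g⁻¹ : G) : G ⧸ conj g H) = ((b * g⁻¹ : G) : G ⧸ conj g H) := h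
    rw [QuotientGroup.eq, mem_conj] at h'
    exact QuotientGroup.eq.2 (by simpa [mul_assoc] using h')
  · intro y
    induction y using Quotient.inductionOn' with | h b =>
    exact ⟨((b * g : G) : G ⧸ H), congrArg (fun z : G => (z : G ⧸ conj g H)) (by group)⟩

theorem cmap_comp_proj (g : G) {K H : Subgroup G} (h : K ≤ H) :
    (cmap g H).comp (proj h) = (proj (conj_mono g h)).comp (cmap g K) := by
  ext v
  induction v using Quotient.inductionOn' with | h k => rfl

theorem proj_refl (H : Subgroup G) : proj (le_refl H) = MulActionHom.id G := by
  ext v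
  induction v using Quotient.inductionOn' with | h k => rfl

/-- Every map of transitive `G`-sets is a conjugation followed by a projection. -/
theorem orbit_hom_factor {K H : Subgroup G} (f : orbit K →[G] orbit H) :
    ∃ (g : G) (h : conj g K ≤ H), f = (proj h).comp (cmap g K) := by
  obtain ⟨a, ha⟩ : ∃ a : G, orbitMk H a = f (orbitMk K 1) := QuotientGroup.mk_surjective _
  have hf : ∀ k : G, f (orbitMk K k) = orbitMk H (k * a) := by
    intro k
    rw [← mul_one k, ← smul_orbitMk, map_smul, ← ha, mul_one]
    rfl
  have hH : conj a⁻¹ K ≤ H := by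
    intro z hz
    rw [mem_conj] at hz
    have h1 : orbitMk K (a⁻¹⁻¹ * z * a⁻¹) = orbitMk K 1 :=
      orbitMk_eq.2 (by simpa using K.inv_mem hz)
    have h2 := (hf _).symm.trans ((congrArg f h1).trans (hf 1))
    simpa [mul_assoc] using H.inv_mem (orbitMk_eq.1 h2)
  refine ⟨a⁻¹, hH, ?_⟩
  ext v
  induction v using Quotient.inductionOn' with | h k =>
  refine (hf k).trans ?_
  exact congrArg (orbitMk H) (congrArg (k * ·) (inv_inv a).symm)

/-- The Mackey double coset formula. -/
theorem Omega.mackey_formula {J K H : Subgroup G} (hJ : J ≤ H) (hK : K ≤ H) :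
    Omega.res (X := orb R J) (Y := orb R H) (proj hJ) ≫
      Omega.tr (X := orb R K) (Y := orb R H) (proj hK) =
    ∑ q : DCos J H K, Omega.tr (X := orb R _) (Y := orb R J) (proj (conj_inf_le q.rep K J)) ≫
      Omega.tr (X := orb R (K ⊓ conj q.rep⁻¹ J)) (Y := orb R _) (cmap q.rep _) ≫
      Omega.res (X := orb R (K ⊓ conj q.rep⁻¹ J)) (Y := orb R K) (proj inf_le_left) := by
  have hq : ∀ q : DCos J H K, ∀ v : orbit (K ⊓ conj q.rep⁻¹ J),
      proj hJ (((proj (conj_inf_le q.rep K J)).comp (cmap q.rep (K ⊓ conj q.rep⁻¹ J))) v) =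
        proj hK (proj (inf_le_left : K ⊓ conj q.rep⁻¹ J ≤ K) v) := by
    intro q v
    induction v using Quotient.inductionOn' with | h k =>
    refine QuotientGroup.eq.2 ?_
    simpa using q.rep_mem
  have h1 : Omega.res (X := orb R J) (Y := orb R H) (proj hJ) ≫
      Omega.tr (X := orb R K) (Y := orb R H) (proj hK) = Omega.span (X := orb R J) (Y := orb R K)
        ((GSpan.res (proj hJ)).comp (GSpan.tr (proj hK))) := Omega.span_comp _ _
  let j : ∀ q : DCos J H K, orbit (K ⊓ conj q.rep⁻¹ J) →[G]
      FinGSet.pullback (proj hJ) (proj hK) := fun q =>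
    { toFun := fun v => (⟨(_, _), hq q v⟩ :
        {p : orbit J × orbit K // proj hJ p.1 = proj hK p.2})
      map_smul' := fun g v => Subtype.ext (Prod.ext (map_smul _ g v) (map_smul _ g v)) }
  rw [h1, Omega.span_eq_sum (X := orb R J) (Y := orb R K) _
    (fun q : DCos J H K => orbit (K ⊓ conj q.rep⁻¹ J)) j]
  · refine Finset.sum_congr rfl fun q _ => ?_
    rw [← Category.assoc, Omega.tr_comp_tr, Omega.tr_comp_res]
    rfl
  · intro q x y h
    induction x using Quotient.inductionOn' with | h a =>
    induction y using Quotient.inductionOn' with | h b =>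
    have e1 := QuotientGroup.eq.1 (congrArg (fun z => z.1.1) h)
    have e2 := QuotientGroup.eq.1 (congrArg (fun z => z.1.2) h)
    refine QuotientGroup.eq.2 (Subgroup.mem_inf.2 ⟨e2, mem_conj.2 ?_⟩)
    simpa [mul_assoc] using e1
  · intro q q' x y h
    induction x using Quotient.inductionOn' with | h a =>
    induction y using Quotient.inductionOn' with | h b =>
    have e1 := QuotientGroup.eq.1 (congrArg (fun z => z.1.1) h)
    have e2 := QuotientGroup.eq.1 (congrArg (fun z => z.1.2) h)
    refine DCos.eq_of_rep (J.inv_mem e1) e2 hJ hK ?_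
    simp only [id_eq]
    group
  · rintro ⟨⟨x, y⟩, h⟩
    induction x using Quotient.inductionOn' with | h x =>
    induction y using Quotient.inductionOn' with | h y =>
    have hh : x⁻¹ * y ∈ H := QuotientGroup.eq.1 h
    obtain ⟨q, a, ha, b, hb, e⟩ := DCos.exists_rep (J := J) (K := K) hh
    refine ⟨q, ((y * b : G) : G ⧸ _), Subtype.ext (Prod.ext ?_ ?_)⟩
    · refine QuotientGroup.eq.2 ?_
      rw [e]
      convert ha using 1
      simp only [id_eq]
      group
    · refine QuotientGroup.eq.2 ?_
      convert K.inv_mem hb using 1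
      simp only [id_eq]
      group

end Finite

end MackeyBox

end

noncomputable section

namespace MackeyBox

variable {R : Type w} [CommRing R] {G : Type u} [Group G]

/-! ### Restrictions and transfers of Mackey functors -/

namespace MackeyFunctor

variable (M : MackeyFunctor.{u, v, w} R G)

theorem r_r {X Y Z : Omega R G} (f : X.gset →[G] Y.gset) (g : Y.gset →[G] Z.gset) (x : M.val Z) :
    M.r f (M.r g x) = M.r (g.comp f) x := by
  unfold r
  rw [← ap_comp, Omega.res_comp_res]

theorem t_t {X Y Z : Omega R G} (f : X.gset →[G] Y.gset) (g : Y.gset →[G] Z.gset) (x : M.val X) :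
    M.t g (M.t f x) = M.t (g.comp f) x := by
  unfold t
  rw [← ap_comp, Omega.tr_comp_tr]

theorem r_t_self {X Y : Omega R G} (f : X.gset →[G] Y.gset) (hf : Function.Injective f)
    (x : M.val X) : M.r f (M.t f x) = x := by
  unfold r t
  rw [← ap_comp, Omega.res_comp_tr_self f hf, ap_id]

theorem t_r_self {X Y : Omega R G} (f : X.gset →[G] Y.gset) (hf : Function.Bijective f)
    (x : M.val Y) : M.t f (M.r f x) = x := by
  unfold r t
  rw [← ap_comp, Omega.tr_comp_res_self f hf, ap_id]

theorem r_id {X : Omega R G} (x : M.val X) : M.r (MulActionHom.id G : X.gset →[G] X.gset) x = x :=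
  M.ap_id X x

theorem t_id {X : Omega R G} (x : M.val X) : M.t (MulActionHom.id G : X.gset →[G] X.gset) x = x :=
  M.ap_id X x

variable [Finite G]

theorem sum_t_r {X : Omega R G} (x : M.val X) :
    ∑ ω : Orbits X.gset, M.t (X := orb R ω.stab) ω.inj (M.r (X := orb R ω.stab) ω.inj x) = x := by
  conv_rhs => rw [← M.ap_id X x, Omega.id_eq_sum, ap_sum]
  simp only [ap_comp]
  rfl

theorem r_t_of_ne {X : Omega R G} {ω ω' : Orbits X.gset} (h : ω ≠ ω')
    (x : M.val (orb R ω'.stab)) :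
    M.r (X := orb R ω.stab) (Y := X) ω.inj (M.t (X := orb R ω'.stab) ω'.inj x) = 0 := by
  unfold r t
  rw [← ap_comp, Orbits.res_comp_tr_of_ne h, ap_zero]

/-- An element of `M(X)` is determined by its restrictions to transitive `G`-sets. -/
theorem ext_r {X : Omega R G} {x y : M.val X}
    (h : ∀ (K : Subgroup G) (f : orbit K →[G] X.gset),
      M.r (X := orb R K) f x = M.r (X := orb R K) f y) : x = y := by
  rw [← M.sum_t_r x, ← M.sum_t_r y]
  exact Finset.sum_congr rfl fun ω _ => by rw [h]

theorem t_cmap_t_proj (g : G) {K H : Subgroup G} (h : K ≤ H) (x : M.val (orb R K)) :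
    M.t (X := orb R H) (Y := orb R (conj g H)) (cmap g H)
        (M.t (X := orb R K) (Y := orb R H) (proj h) x) =
      M.t (X := orb R (conj g K)) (Y := orb R (conj g H)) (proj (conj_mono g h))
        (M.t (X := orb R K) (Y := orb R (conj g K)) (cmap g K) x) := by
  rw [t_t, t_t]
  exact congrArg (fun f => M.t (X := orb R K) (Y := orb R (conj g H)) f x) (cmap_comp_proj g h)

theorem r_proj_t_proj {J K H : Subgroup G} (hJ : J ≤ H) (hK : K ≤ H) (x : M.val (orb R K)) :
    M.r (X := orb R J) (Y := orb R H) (proj hJ)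
        (M.t (X := orb R K) (Y := orb R H) (proj hK) x) =
      ∑ q : DCos J H K,
        M.t (X := orb R _) (Y := orb R J) (proj (conj_inf_le q.rep K J))
          (M.t (X := orb R (K ⊓ conj q.rep⁻¹ J)) (Y := orb R _) (cmap q.rep _)
            (M.r (X := orb R (K ⊓ conj q.rep⁻¹ J)) (Y := orb R K) (proj inf_le_left) x)) := by
  unfold r t
  rw [← ap_comp, Omega.mackey_formula, ap_sum]
  simp only [ap_comp]

end MackeyFunctor

/-! ### Dress pairings and transitive `G`-sets -/

theorem DressPairing.t_of_bijective {M N P : MackeyFunctor.{u, v, w} R G}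
    (θ : DressPairing M N P) {X Y : Omega R G} (f : X.gset →[G] Y.gset) (hf : Function.Bijective f)
    (m : M.val X) (n : N.val X) :
    P.t f (θ.θ X (m ⊗ₜ n)) = θ.θ Y (M.t f m ⊗ₜ N.t f n) := by
  rw [← θ.frob_left, N.r_t_self f hf.1]

section Pairing

variable [Finite G] {M N P : MackeyFunctor.{u, v, w} R G}

theorem DressPairing.ext_orb {θ θ' : DressPairing M N P}
    (h : ∀ (H : Subgroup G) (m : M.val (orb R H)) (n : N.val (orb R H)),
      θ.θ (orb R H) (m ⊗ₜ n) = θ'.θ (orb R H) (m ⊗ₜ n)) : θ = θ' := by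
  ext X : 2
  refine TensorProduct.ext' fun m n => P.ext_r fun K f => ?_
  rw [θ.res, θ'.res, h]

variable (M N P) in
/-- A Dress pairing defined on the transitive `G`-sets `G/H` only. -/
structure OrbitPairing where
  /-- the maps `M(G/H) ⊗ N(G/H) → P(G/H)` -/
  θ : ∀ H : Subgroup G, M.val (orb R H) ⊗[R] N.val (orb R H) →ₗ[R] P.val (orb R H)
  res : ∀ {K H : Subgroup G} (f : orbit K →[G] orbit H) (m : M.val (orb R H))
    (n : N.val (orb R H)), P.r (X := orb R K) (Y := orb R H) f (θ H (m ⊗ₜ n)) =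
      θ K (M.r (X := orb R K) (Y := orb R H) f m ⊗ₜ N.r (X := orb R K) (Y := orb R H) f n)
  frob_left : ∀ {K H : Subgroup G} (f : orbit K →[G] orbit H) (m : M.val (orb R K))
    (n : N.val (orb R H)),
    P.t (X := orb R K) (Y := orb R H) f (θ K (m ⊗ₜ N.r (X := orb R K) (Y := orb R H) f n)) =
      θ H (M.t (X := orb R K) (Y := orb R H) f m ⊗ₜ n)
  frob_right : ∀ {K H : Subgroup G} (f : orbit K →[G] orbit H) (m : M.val (orb R H))
    (n : N.val (orb R K)),
    P.t (X := orb R K) (Y := orb R H) f (θ K (M.r (X := orb R K) (Y := orb R H) f m ⊗ₜ n)) =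
      θ H (m ⊗ₜ N.t (X := orb R K) (Y := orb R H) f n)

namespace OrbitPairing

variable (θ : OrbitPairing M N P)

/-- The extension of a pairing from transitive to all finite `G`-sets, orbit by orbit. -/
def ext (X : Omega R G) : M.val X ⊗[R] N.val X →ₗ[R] P.val X :=
  ∑ ω : Orbits X.gset, P.t (X := orb R ω.stab) ω.inj ∘ₗ θ.θ ω.stab ∘ₗ
    TensorProduct.map (M.r (X := orb R ω.stab) ω.inj) (N.r (X := orb R ω.stab) ω.inj)

theorem ext_tmul {X : Omega R G} (m : M.val X) (n : N.val X) :
    θ.ext X (m ⊗ₜ n) = ∑ ω : Orbits X.gset, P.t (X := orb R ω.stab) ω.inj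
      (θ.θ ω.stab (M.r (X := orb R ω.stab) ω.inj m ⊗ₜ N.r (X := orb R ω.stab) ω.inj n)) := by
  simp [ext, LinearMap.sum_apply]

theorem r_ext {X : Omega R G} {K : Subgroup G} (f : orbit K →[G] X.gset) (m : M.val X)
    (n : N.val X) : P.r (X := orb R K) f (θ.ext X (m ⊗ₜ n)) =
      θ.θ K (M.r (X := orb R K) f m ⊗ₜ N.r (X := orb R K) f n) := by
  obtain ⟨ω, f', rfl⟩ := Orbits.exists_factor f
  have h : P.r (X := orb R ω.stab) ω.inj (θ.ext X (m ⊗ₜ n)) =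
      θ.θ ω.stab (M.r (X := orb R ω.stab) ω.inj m ⊗ₜ N.r (X := orb R ω.stab) ω.inj n) := by
    rw [ext_tmul, map_sum, Finset.sum_eq_single ω]
    · exact P.r_t_self (X := orb R ω.stab) _ ω.inj_injective _
    · intro ω' _ hω
      exact P.r_t_of_ne hω.symm _
    · simp
  have hr : ∀ (Q : MackeyFunctor.{u, v, w} R G) (x : Q.val X),
      Q.r (X := orb R K) (ω.inj.comp f') x =
        Q.r (X := orb R K) (Y := orb R ω.stab) f' (Q.r (X := orb R ω.stab) ω.inj x) :=
    fun Q x => (Q.r_r (X := orb R K) (Y := orb R ω.stab) f' ω.inj x).symm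
  rw [hr, hr, hr, h, θ.res]

theorem ext_t_left {X : Omega R G} {K : Subgroup G} (f : orbit K →[G] X.gset)
    (m : M.val (orb R K)) (n : N.val X) : θ.ext X (M.t (X := orb R K) f m ⊗ₜ n) =
      P.t (X := orb R K) f (θ.θ K (m ⊗ₜ N.r (X := orb R K) f n)) := by
  obtain ⟨ω, f', rfl⟩ := Orbits.exists_factor f
  have ht : ∀ (Q : MackeyFunctor.{u, v, w} R G) (x : Q.val (orb R K)),
      Q.t (X := orb R K) (ω.inj.comp f') x =
        Q.t (X := orb R ω.stab) ω.inj (Q.t (X := orb R K) (Y := orb R ω.stab) f' x) :=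
    fun Q x => (Q.t_t (X := orb R K) (Y := orb R ω.stab) f' ω.inj x).symm
  have hr : N.r (X := orb R K) (ω.inj.comp f') n =
      N.r (X := orb R K) (Y := orb R ω.stab) f' (N.r (X := orb R ω.stab) ω.inj n) :=
    (N.r_r (X := orb R K) (Y := orb R ω.stab) f' ω.inj n).symm
  rw [ht, ht, hr, θ.frob_left, ext_tmul, Finset.sum_eq_single ω]
  · rw [M.r_t_self (X := orb R ω.stab) _ ω.inj_injective]
  · intro ω' _ hω
    rw [M.r_t_of_ne hω, TensorProduct.zero_tmul, map_zero, map_zero]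
  · simp

theorem ext_t_right {X : Omega R G} {K : Subgroup G} (f : orbit K →[G] X.gset)
    (m : M.val X) (n : N.val (orb R K)) : θ.ext X (m ⊗ₜ N.t (X := orb R K) f n) =
      P.t (X := orb R K) f (θ.θ K (M.r (X := orb R K) f m ⊗ₜ n)) := by
  obtain ⟨ω, f', rfl⟩ := Orbits.exists_factor f
  have ht : ∀ (Q : MackeyFunctor.{u, v, w} R G) (x : Q.val (orb R K)),
      Q.t (X := orb R K) (ω.inj.comp f') x =
        Q.t (X := orb R ω.stab) ω.inj (Q.t (X := orb R K) (Y := orb R ω.stab) f' x) :=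
    fun Q x => (Q.t_t (X := orb R K) (Y := orb R ω.stab) f' ω.inj x).symm
  have hr : M.r (X := orb R K) (ω.inj.comp f') m =
      M.r (X := orb R K) (Y := orb R ω.stab) f' (M.r (X := orb R ω.stab) ω.inj m) :=
    (M.r_r (X := orb R K) (Y := orb R ω.stab) f' ω.inj m).symm
  rw [ht, ht, hr, θ.frob_right, ext_tmul, Finset.sum_eq_single ω]
  · rw [N.r_t_self (X := orb R ω.stab) _ ω.inj_injective]
  · intro ω' _ hω
    rw [N.r_t_of_ne hω, TensorProduct.tmul_zero, map_zero, map_zero]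
  · simp

/-- A Dress pairing on the transitive `G`-sets extends to all finite `G`-sets. -/
def toDress : DressPairing M N P where
  θ := θ.ext
  res {X Y} f m n := P.ext_r fun K k => by
    rw [θ.r_ext, P.r_r, M.r_r, N.r_r, θ.r_ext]
  frob_left {X Y} f m n := by
    rw [← M.sum_t_r m]
    simp only [TensorProduct.sum_tmul, map_sum]
    refine Finset.sum_congr rfl fun ω _ => ?_
    rw [θ.ext_t_left, P.t_t, M.t_t, θ.ext_t_left, N.r_r]
  frob_right {X Y} f m n := by
    rw [← N.sum_t_r n]
    simp only [TensorProduct.tmul_sum, map_sum]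
    refine Finset.sum_congr rfl fun ω _ => ?_
    rw [θ.ext_t_right, P.t_t, N.t_t, θ.ext_t_right, M.r_r]

theorem toDress_orb (H : Subgroup G) (m : M.val (orb R H)) (n : N.val (orb R H)) :
    θ.toDress.θ (orb R H) (m ⊗ₜ n) = θ.θ H (m ⊗ₜ n) := by
  have h := θ.r_ext (X := orb R H) (MulActionHom.id G) m n
  rwa [P.r_id, M.r_id, N.r_id] at h

end OrbitPairing

end Pairing

end MackeyBox

end

noncomputable section

namespace MackeyBox

variable {R : Type w} [CommRing R] {G : Type u} [Group G] [Finite G]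

/-! ### Maps out of the box product -/

section BoxHom

variable (R) (M : Type*) [AddCommGroup M] [Module R M] [Module (MackeyAlgebra R G) M]
  [IsScalarTower R (MackeyAlgebra R G) M] (N : Type*) [AddCommGroup N] [Module R N]
  [Module (MackeyAlgebra R G) N] [IsScalarTower R (MackeyAlgebra R G) N]

theorem BoxSum.pr_inc (H : Subgroup G) (x : BoxGrade R M N H) :
    BoxSum.pr R M N H (BoxSum.inc R M N H x) = x := by
  classical
  exact Pi.single_eq_same (M := fun H : Subgroup G => BoxGrade R M N H) H x

theorem BoxGrade.ind_self (H : Subgroup G) (x : BoxGrade R M N H) :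
    BoxGrade.ind R M N (le_refl H) x = x := by
  simp [BoxGrade.ind]

theorem BoxGrade.ind_of_lt {K H : Subgroup G} (h : K < H) (x : BoxGrade R M N K) :
    BoxGrade.ind R M N h.le x = BoxGrade.up R M N h x := by
  simp [BoxGrade.ind, h.ne]

theorem BoxSum.op_ind_inc {K H : Subgroup G} (h : K ≤ H) (x : BoxGrade R M N K) :
    BoxSum.op R M N (.ind K H h) (BoxSum.inc R M N K x) =
      BoxSum.inc R M N H (BoxGrade.ind R M N h x) := by
  change BoxSum.inc R M N H (BoxGrade.ind R M N h (BoxSum.pr R M N K (BoxSum.inc R M N K x))) = _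
  rw [BoxSum.pr_inc]

theorem BoxSum.op_con_first (g : G) {H : Subgroup G} (x : Tens R M N H) :
    BoxSum.op R M N (.con g H) (BoxSum.inc R M N H (BoxGrade.first R M N H x)) =
      BoxSum.inc R M N _ (BoxGrade.first R M N _
        (TensorProduct.map (gradeCon R M g H) (gradeCon R N g H) x)) := by
  change BoxSum.inc R M N _ (BoxGrade.con R M N g H
    (BoxSum.pr R M N H (BoxSum.inc R M N H (BoxGrade.first R M N H x)))) = _
  rw [BoxSum.pr_inc]
  exact congrArg _ (BoxGrade.lift_inc R M N _ (SubChain.base H) x)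

theorem BoxSum.op_res_first {K H : Subgroup G} (h : K ≤ H) (x : Tens R M N H) :
    BoxSum.op R M N (.res K H h) (BoxSum.inc R M N H (BoxGrade.first R M N H x)) =
      BoxSum.inc R M N _ (BoxGrade.first R M N _
        (TensorProduct.map (gradeRes R M h) (gradeRes R N h) x)) := by
  change BoxSum.inc R M N _ (BoxGrade.res R M N h
    (BoxSum.pr R M N H (BoxSum.inc R M N H (BoxGrade.first R M N H x)))) = _
  rw [BoxSum.pr_inc]
  exact congrArg _ (BoxGrade.lift_inc R M N _ (SubChain.base H) x)

theorem BoxSum.hom_ext {Q : Type*} [AddCommGroup Q] [Module R Q]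
    {f g : BoxSum (G := G) R M N →ₗ[R] Q}
    (h : ∀ H x, f (BoxSum.inc R M N H x) = g (BoxSum.inc R M N H x)) : f = g := by
  classical
  exact LinearMap.pi_ext' fun H => LinearMap.ext (h H)

variable {R M N}

theorem Box.hom_mk_op {Q : Type*} [AddCommGroup Q] [Module (MackeyAlgebra R G) Q]
    (β : Box (G := G) R M N →ₗ[MackeyAlgebra R G] Q) (s : Gen G)
    (x : BoxSum (G := G) R M N) :
    β (Box.mk R M N (BoxSum.op R M N s x)) = s.elem R • β (Box.mk R M N x) := by
  rw [← Box.elem_smul_mk, map_smul]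

variable {Q : Type*} [AddCommGroup Q] [Module R Q] [Module (MackeyAlgebra R G) Q]
  [IsScalarTower R (MackeyAlgebra R G) Q]

theorem BoxSum.hom_act {f : BoxSum (G := G) R M N →ₗ[R] Q}
    (hf : ∀ (s : Gen G) x, f (BoxSum.op R M N s x) = s.elem R • f x)
    (p : FreeAlgebra R (Gen G)) (x : BoxSum (G := G) R M N) :
    f (BoxSum.act R M N p x) = evalGen R G p • f x := by
  induction p using FreeAlgebra.induction generalizing x with
  | grade0 r =>
    simp only [AlgHom.commutes, Module.algebraMap_end_apply, map_smul, algebraMap_smul]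
  | grade1 s => rw [BoxSum.act_ι, evalGen_ι, hf]
  | mul a b ha hb => simp only [map_mul, Module.End.mul_apply, ha, hb, mul_smul]
  | add a b ha hb => simp only [map_add, LinearMap.add_apply, ha, hb, add_smul]

theorem BoxSum.ker_le_ker {f : BoxSum (G := G) R M N →ₗ[R] Q}
    (hf : ∀ (s : Gen G) x, f (BoxSum.op R M N s x) = s.elem R • f x)
    (hFR : ∀ x ∈ BoxSum.FR (G := G) R M N, f x = 0) :
    BoxSum.ker R M N ≤ LinearMap.ker f := by
  refine sup_le (fun x hx => hFR x hx) (Submodule.span_le.2 ?_)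
  rintro y ⟨p, x, hp, rfl⟩
  change f _ = 0
  rw [BoxSum.hom_act hf, hp, zero_smul]

/-- The map out of the box product given by a map out of `A` which commutes with the operators
and kills the Frobenius reciprocity submodule. -/
def Box.lift (f : BoxSum (G := G) R M N →ₗ[R] Q)
    (hf : ∀ (s : Gen G) x, f (BoxSum.op R M N s x) = s.elem R • f x)
    (hFR : ∀ x ∈ BoxSum.FR (G := G) R M N, f x = 0) :
    Box (G := G) R M N →ₗ[MackeyAlgebra R G] Q where
  toFun := (BoxSum.ker R M N).liftQ f (BoxSum.ker_le_ker hf hFR)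
  map_add' := map_add _
  map_smul' a y := by
    obtain ⟨p, rfl⟩ := evalGen_surjective a
    obtain ⟨x, rfl⟩ := Box.mk_surjective R M N y
    rw [Box.evalGen_smul_mk]
    exact BoxSum.hom_act hf p x

theorem Box.mk_eq_zero {x : BoxSum (G := G) R M N} (hx : x ∈ BoxSum.FR R M N) :
    Box.mk R M N x = 0 :=
  (Submodule.Quotient.mk_eq_zero _).2 (Submodule.mem_sup_left hx)

/-- Maps out of the box product correspond to maps out of `A` which commute with the operators and
kill the Frobenius reciprocity submodule. -/
theorem Box.bijOn_comp_mk :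
    Set.BijOn (fun β : Box (G := G) R M N →ₗ[MackeyAlgebra R G] Q =>
        β.restrictScalars R ∘ₗ Box.mk R M N) Set.univ
      {f : BoxSum (G := G) R M N →ₗ[R] Q |
        (∀ (s : Gen G) (x : BoxSum (G := G) R M N),
          f (BoxSum.op R M N s x) = s.elem R • f x) ∧
        ∀ x ∈ BoxSum.FR (G := G) R M N, f x = 0} := by
  refine ⟨fun β _ => ⟨fun s x => Box.hom_mk_op β s x, fun x hx => ?_⟩, fun β _ γ _ h => ?_,
    fun f hf => ⟨Box.lift f hf.1 hf.2, trivial, rfl⟩⟩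
  · change β (Box.mk R M N x) = 0
    rw [Box.mk_eq_zero hx, map_zero]
  · ext y
    obtain ⟨x, rfl⟩ := Box.mk_surjective R M N y
    exact LinearMap.congr_fun h x

/-- Maps out of the box product are determined by their values on the first summands. -/
theorem Box.hom_ext {β γ : Box (G := G) R M N →ₗ[MackeyAlgebra R G] Q}
    (h : ∀ (H : Subgroup G) (m : grade R M H) (n : grade R N H),
      β (Box.mk R M N (BoxSum.inc R M N H (BoxGrade.first R M N H (m ⊗ₜ n)))) =
        γ (Box.mk R M N (BoxSum.inc R M N H (BoxGrade.first R M N H (m ⊗ₜ n))))) : β = γ := by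
  refine Box.bijOn_comp_mk.injOn (Set.mem_univ β) (Set.mem_univ γ)
    (BoxSum.hom_ext R M N fun H x => LinearMap.congr_fun
      (f := (β.restrictScalars R ∘ₗ Box.mk R M N) ∘ₗ BoxSum.inc R M N H)
      (g := (γ.restrictScalars R ∘ₗ Box.mk R M N) ∘ₗ BoxSum.inc R M N H)
      (BoxGrade.hom_ext R M N fun c y => ?_) x)
  change β (Box.mk R M N (BoxSum.inc R M N H (BoxGrade.inc R M N c y))) =
    γ (Box.mk R M N (BoxSum.inc R M N H (BoxGrade.inc R M N c y)))
  clear x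
  induction c with
  | base H =>
    exact LinearMap.congr_fun
      (f := (β.restrictScalars R ∘ₗ Box.mk R M N) ∘ₗ BoxSum.inc R M N H ∘ₗ BoxGrade.first R M N H)
      (g := (γ.restrictScalars R ∘ₗ Box.mk R M N) ∘ₗ BoxSum.inc R M N H ∘ₗ BoxGrade.first R M N H)
      (TensorProduct.ext' (h H)) y
  | step hlt c ih =>
    have e : BoxSum.inc R M N _ (BoxGrade.inc R M N (SubChain.step hlt c) y) =
        BoxSum.op R M N (.ind _ _ hlt.le) (BoxSum.inc R M N _ (BoxGrade.inc R M N c y)) := by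
      rw [BoxSum.op_ind_inc, BoxGrade.ind_of_lt R M N hlt]
      exact congrArg _ (BoxGrade.up_inc R M N hlt c y).symm
    rw [e, Box.hom_mk_op, Box.hom_mk_op]
    exact congrArg _ (ih y)

end BoxHom

/-! ### From Dress pairings to module maps -/

section DressToHom

variable {M N P : MackeyFunctor.{u, v, w} R G}

theorem Phi.gr_symm_gradeMul (M : MackeyFunctor.{u, v, w} R G) {H K : Subgroup G}
    (f : orb R H ⟶ orb R K) (x : grade R (Phi M) K) :
    (Phi.gr M H).symm (gradeMul (Phi M) f x) = M.ap f ((Phi.gr M K).symm x) := by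
  change (MackeyAlgebra.single H K f • (x : Phi M)) H = M.ap f ((x : Phi M) K)
  rw [Phi.single_smul, Phi.inc_same]

theorem Phi.gradeMul_gr (M : MackeyFunctor.{u, v, w} R G) {H K : Subgroup G}
    (f : orb R H ⟶ orb R K) (m : M.val (orb R K)) :
    gradeMul (Phi M) f (Phi.gr M K m) = Phi.gr M H (M.ap f m) := by
  rw [← LinearEquiv.symm_apply_eq, Phi.gr_symm_gradeMul, LinearEquiv.symm_apply_apply]

namespace DressPairing

variable (θ : DressPairing M N P)

/-- The pairing on the first summand of the grade `H`. -/
def onTens (H : Subgroup G) : Tens R (Phi M) (Phi N) H →ₗ[R] P.val (orb R H) :=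
  θ.θ (orb R H) ∘ₗ TensorProduct.map (Phi.gr M H).symm.toLinearMap (Phi.gr N H).symm.toLinearMap

theorem onTens_tmul {H : Subgroup G} (m : grade R (Phi M) H) (n : grade R (Phi N) H) :
    θ.onTens H (m ⊗ₜ n) = θ.θ (orb R H) ((Phi.gr M H).symm m ⊗ₜ (Phi.gr N H).symm n) := rfl

/-- The map given by a pairing on the summand of a chain: the pairing, followed by transfers. -/
def onChain : {H : Subgroup G} → (c : SubChain H) →
    (Tens R (Phi M) (Phi N) c.bot →ₗ[R] P.val (orb R H))
  | _, .base H => θ.onTens H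
  | H, .step (K := K) h c => P.t (X := orb R K) (Y := orb R H) (proj h.le) ∘ₗ onChain c

/-- The map `A_H → P(G/H)` given by a pairing. -/
def onGrade (H : Subgroup G) : BoxGrade R (Phi M) (Phi N) H →ₗ[R] P.val (orb R H) :=
  BoxGrade.lift R (Phi M) (Phi N) fun c => θ.onChain c

theorem onGrade_inc {H : Subgroup G} (c : SubChain H) (x : Tens R (Phi M) (Phi N) c.bot) :
    θ.onGrade H (BoxGrade.inc R _ _ c x) = θ.onChain c x :=
  BoxGrade.lift_inc R _ _ _ c x

theorem onGrade_first (H : Subgroup G) (x : Tens R (Phi M) (Phi N) H) :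
    θ.onGrade H (BoxGrade.first R _ _ H x) = θ.onTens H x :=
  θ.onGrade_inc (SubChain.base H) x

theorem onGrade_up {K H : Subgroup G} (h : K < H) (x : BoxGrade R (Phi M) (Phi N) K) :
    θ.onGrade H (BoxGrade.up R _ _ h x) =
      P.t (X := orb R K) (Y := orb R H) (proj h.le) (θ.onGrade K x) := by
  refine LinearMap.congr_fun (f := θ.onGrade H ∘ₗ BoxGrade.up R _ _ h)
    (g := P.t (X := orb R K) (Y := orb R H) (proj h.le) ∘ₗ θ.onGrade K)
    (BoxGrade.hom_ext R _ _ fun c x => ?_) x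
  rw [LinearMap.comp_apply, LinearMap.comp_apply, BoxGrade.up_inc, onGrade_inc]
  exact (θ.onGrade_inc (SubChain.step h c) x)

theorem onGrade_ind {K H : Subgroup G} (h : K ≤ H) (x : BoxGrade R (Phi M) (Phi N) K) :
    θ.onGrade H (BoxGrade.ind R _ _ h x) =
      P.t (X := orb R K) (Y := orb R H) (proj h) (θ.onGrade K x) := by
  rcases h.eq_or_lt with rfl | hlt
  · rw [BoxGrade.ind_self, proj_refl]
    exact (P.t_id _).symm
  · rw [BoxGrade.ind_of_lt R _ _ hlt, onGrade_up]

theorem onTens_con (g : G) (H : Subgroup G) (x : Tens R (Phi M) (Phi N) H) :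
    θ.onTens (conj g H)
        (TensorProduct.map (gradeCon R (Phi M) g H) (gradeCon R (Phi N) g H) x) =
      P.t (X := orb R H) (Y := orb R (conj g H)) (cmap g H) (θ.onTens H x) := by
  induction x using TensorProduct.induction_on with
  | zero => simp only [map_zero]
  | add x y hx hy => simp only [map_add, hx, hy]
  | tmul m n =>
    rw [TensorProduct.map_tmul, onTens_tmul, onTens_tmul, gradeCon, gradeCon,
      Phi.gr_symm_gradeMul, Phi.gr_symm_gradeMul]
    exact (θ.t_of_bijective (X := orb R H) (Y := orb R (conj g H)) _ (cmap_bijective g H) _ _).symm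

theorem onTens_res {J H : Subgroup G} (h : J ≤ H) (x : Tens R (Phi M) (Phi N) H) :
    θ.onTens J (TensorProduct.map (gradeRes R (Phi M) h) (gradeRes R (Phi N) h) x) =
      P.r (X := orb R J) (Y := orb R H) (proj h) (θ.onTens H x) := by
  induction x using TensorProduct.induction_on with
  | zero => simp only [map_zero]
  | add x y hx hy => simp only [map_add, hx, hy]
  | tmul m n =>
    rw [TensorProduct.map_tmul, onTens_tmul, onTens_tmul, gradeRes, gradeRes,
      Phi.gr_symm_gradeMul, Phi.gr_symm_gradeMul]
    exact (θ.res (X := orb R J) (Y := orb R H) _ _ _).symm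

theorem onGrade_con (g : G) (H : Subgroup G) (x : BoxGrade R (Phi M) (Phi N) H) :
    θ.onGrade (conj g H) (BoxGrade.con R _ _ g H x) =
      P.t (X := orb R H) (Y := orb R (conj g H)) (cmap g H) (θ.onGrade H x) := by
  refine LinearMap.congr_fun (f := θ.onGrade (conj g H) ∘ₗ BoxGrade.con R _ _ g H)
    (g := P.t (X := orb R H) (Y := orb R (conj g H)) (cmap g H) ∘ₗ θ.onGrade H)
    (BoxGrade.hom_ext R _ _ fun c y => ?_) x
  rw [LinearMap.comp_apply, LinearMap.comp_apply, onGrade_inc, BoxGrade.con, BoxGrade.lift_inc]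
  clear x
  induction c with
  | base H => exact (θ.onGrade_first _ _).trans (θ.onTens_con g H y)
  | step h c ih =>
    refine (θ.onGrade_up _ _).trans ((congrArg _ (ih y)).trans ?_)
    exact (P.t_cmap_t_proj g h.le _).symm

theorem onGrade_res {J H : Subgroup G} (h : J ≤ H) (x : BoxGrade R (Phi M) (Phi N) H) :
    θ.onGrade J (BoxGrade.res R _ _ h x) =
      P.r (X := orb R J) (Y := orb R H) (proj h) (θ.onGrade H x) := by
  refine LinearMap.congr_fun (f := θ.onGrade J ∘ₗ BoxGrade.res R _ _ h)
    (g := P.r (X := orb R J) (Y := orb R H) (proj h) ∘ₗ θ.onGrade H)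
    (BoxGrade.hom_ext R _ _ fun c y => ?_) x
  rw [LinearMap.comp_apply, LinearMap.comp_apply, onGrade_inc, BoxGrade.res, BoxGrade.lift_inc]
  clear x
  induction c generalizing J with
  | base H => exact (θ.onGrade_first _ _).trans (θ.onTens_res h y)
  | step hlt c ih =>
    simp only [BoxGrade.resChain]
    rw [LinearMap.sum_apply, map_sum]
    refine Eq.trans ?_ (P.r_proj_t_proj h hlt.le _).symm
    refine Finset.sum_congr rfl fun q _ => ?_
    refine (θ.onGrade_ind _ _).trans (congrArg _ ((θ.onGrade_con _ _ _).trans (congrArg _ ?_)))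
    exact ih _ y

/-- The map `A → Φ P` given by a pairing. -/
def onSum : BoxSum (G := G) R (Phi M) (Phi N) →ₗ[R] Phi P :=
  LinearMap.pi (φ := fun H : Subgroup G => P.val (orb R H))
    fun H => θ.onGrade H ∘ₗ BoxSum.pr R _ _ H

theorem onSum_inc (H : Subgroup G) (x : BoxGrade R (Phi M) (Phi N) H) :
    θ.onSum (BoxSum.inc R _ _ H x) = Phi.inc P H (θ.onGrade H x) := by
  classical
  refine funext fun K => ?_
  change θ.onGrade K (Pi.single H x K : BoxGrade R (Phi M) (Phi N) K) = _
  by_cases h : K = H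
  · subst h
    rw [Phi.inc_same, Pi.single_eq_same]
  · rw [Phi.inc_ne P h, Pi.single_eq_of_ne h, map_zero]

theorem onSum_op (s : Gen G) (x : BoxSum (G := G) R (Phi M) (Phi N)) :
    θ.onSum (BoxSum.op R _ _ s x) = s.elem R • θ.onSum x := by
  cases s with
  | res K H h =>
    refine (θ.onSum_inc K _).trans (Eq.trans (congrArg _ (θ.onGrade_res h _)) ?_)
    exact (Phi.single_smul P (Omega.res (X := orb R K) (Y := orb R H) (proj h))
      (θ.onSum x)).symm
  | ind K H h =>
    refine (θ.onSum_inc H _).trans (Eq.trans (congrArg _ (θ.onGrade_ind h _)) ?_)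
    exact (Phi.single_smul P (Omega.tr (X := orb R K) (Y := orb R H) (proj h))
      (θ.onSum x)).symm
  | con g H =>
    refine (θ.onSum_inc _ _).trans (Eq.trans (congrArg _ (θ.onGrade_con g H _)) ?_)
    exact (Phi.single_smul P (Omega.tr (X := orb R H) (Y := orb R (conj g H)) (cmap g H))
      (θ.onSum x)).symm

theorem onSum_frob {x : BoxSum (G := G) R (Phi M) (Phi N)} (hx : BoxSum.IsFrob R _ _ x) :
    θ.onSum x = 0 := by
  cases hx with
  | @right K H h a b =>
    rw [map_sub, BoxSum.op_ind_inc, onSum_inc, onSum_inc, onGrade_ind, onGrade_first,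
      onGrade_first, onTens_tmul, onTens_tmul, gradeInd, gradeRes, Phi.gr_symm_gradeMul,
      Phi.gr_symm_gradeMul, sub_eq_zero]
    exact congrArg _ (θ.frob_right (X := orb R K) (Y := orb R H) (proj h.le) _ _).symm
  | @left K H h c d =>
    rw [map_sub, BoxSum.op_ind_inc, onSum_inc, onSum_inc, onGrade_ind, onGrade_first,
      onGrade_first, onTens_tmul, onTens_tmul, gradeInd, gradeRes, Phi.gr_symm_gradeMul,
      Phi.gr_symm_gradeMul, sub_eq_zero]
    exact congrArg _ (θ.frob_left (X := orb R K) (Y := orb R H) (proj h.le) _ _).symm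

theorem onSum_FR (x : BoxSum (G := G) R (Phi M) (Phi N)) (hx : x ∈ BoxSum.FR R _ _) :
    θ.onSum x = 0 := by
  have h : BoxSum.FR R (Phi M) (Phi N) ≤ LinearMap.ker θ.onSum := by
    refine sInf_le ⟨fun x hx => θ.onSum_frob hx, fun s x hx => ?_⟩
    have hx' : θ.onSum x = 0 := hx
    change θ.onSum _ = 0
    rw [onSum_op, hx', smul_zero]
  exact h hx

/-- The module map given by a Dress pairing. -/
def toHom : Box (G := G) R (Phi M) (Phi N) →ₗ[MackeyAlgebra R G] Phi P :=
  Box.lift θ.onSum θ.onSum_op θ.onSum_FR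

theorem toHom_firstTensor (H : Subgroup G) (m : M.val (orb R H)) (n : N.val (orb R H)) :
    θ.toHom (firstTensor M N H m n) = Phi.inc P H (θ.θ (orb R H) (m ⊗ₜ n)) := by
  refine (θ.onSum_inc H _).trans ?_
  rw [onGrade_first, onTens_tmul, LinearEquiv.symm_apply_apply, LinearEquiv.symm_apply_apply]

end DressPairing

end DressToHom

/-! ### From module maps to Dress pairings -/

section HomToDress

variable {M N P : MackeyFunctor.{u, v, w} R G}

theorem Box.phi_hom_ext {β γ : Box (G := G) R (Phi M) (Phi N) →ₗ[MackeyAlgebra R G] Phi P}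
    (h : ∀ (H : Subgroup G) (m : M.val (orb R H)) (n : N.val (orb R H)),
      β (firstTensor M N H m n) = γ (firstTensor M N H m n)) : β = γ := by
  refine Box.hom_ext fun H m n => ?_
  have := h H ((Phi.gr M H).symm m) ((Phi.gr N H).symm n)
  rwa [firstTensor, LinearEquiv.apply_symm_apply, LinearEquiv.apply_symm_apply] at this

theorem conEl_smul_firstTensor (g : G) (H : Subgroup G) (m : M.val (orb R H))
    (n : N.val (orb R H)) :
    (MackeyAlgebra.conEl g H : MackeyAlgebra R G) • firstTensor M N H m n =
      firstTensor M N (conj g H) (M.t (X := orb R H) (Y := orb R (conj g H)) (cmap g H) m)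
        (N.t (X := orb R H) (Y := orb R (conj g H)) (cmap g H) n) := by
  refine (Box.elem_smul_mk R _ _ (.con g H) _).trans ?_
  rw [BoxSum.op_con_first, TensorProduct.map_tmul, gradeCon, gradeCon, Phi.gradeMul_gr,
    Phi.gradeMul_gr]
  rfl

theorem resEl_smul_firstTensor {K H : Subgroup G} (h : K ≤ H) (m : M.val (orb R H))
    (n : N.val (orb R H)) :
    (MackeyAlgebra.resEl h : MackeyAlgebra R G) • firstTensor M N H m n =
      firstTensor M N K (M.r (X := orb R K) (Y := orb R H) (proj h) m)
        (N.r (X := orb R K) (Y := orb R H) (proj h) n) := by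
  refine (Box.elem_smul_mk R _ _ (.res K H h) _).trans ?_
  rw [BoxSum.op_res_first, TensorProduct.map_tmul, gradeRes, gradeRes, Phi.gradeMul_gr,
    Phi.gradeMul_gr]
  rfl

theorem indEl_self_smul_firstTensor (H : Subgroup G) (m : M.val (orb R H))
    (n : N.val (orb R H)) :
    (MackeyAlgebra.indEl (le_refl H) : MackeyAlgebra R G) • firstTensor M N H m n =
      firstTensor M N H m n := by
  refine (Box.elem_smul_mk R _ _ (.ind H H le_rfl) _).trans ?_
  rw [BoxSum.op_ind_inc, BoxGrade.ind_self]
  rfl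

theorem indEl_smul_firstTensor_left {K H : Subgroup G} (h : K ≤ H) (m : M.val (orb R K))
    (n : N.val (orb R H)) :
    (MackeyAlgebra.indEl h : MackeyAlgebra R G) •
        firstTensor M N K m (N.r (X := orb R K) (Y := orb R H) (proj h) n) =
      firstTensor M N H (M.t (X := orb R K) (Y := orb R H) (proj h) m) n := by
  rcases h.eq_or_lt with rfl | hlt
  · rw [indEl_self_smul_firstTensor, proj_refl]
    exact congrArg₂ (firstTensor M N K) (M.t_id m).symm (N.r_id n)
  · have e := Box.mk_eq_zero (BoxSum.frob_mem_FR
      (BoxSum.IsFrob.left (R := R) hlt (Phi.gr M K m) (Phi.gr N H n)))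
    rw [map_sub, sub_eq_zero, gradeInd, gradeRes, Phi.gradeMul_gr, Phi.gradeMul_gr] at e
    exact (Box.elem_smul_mk R _ _ (.ind K H h) _).trans e.symm

theorem indEl_smul_firstTensor_right {K H : Subgroup G} (h : K ≤ H) (m : M.val (orb R H))
    (n : N.val (orb R K)) :
    (MackeyAlgebra.indEl h : MackeyAlgebra R G) •
        firstTensor M N K (M.r (X := orb R K) (Y := orb R H) (proj h) m) n =
      firstTensor M N H m (N.t (X := orb R K) (Y := orb R H) (proj h) n) := by
  rcases h.eq_or_lt with rfl | hlt
  · rw [indEl_self_smul_firstTensor, proj_refl]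
    exact congrArg₂ (firstTensor M N K) (M.r_id m) (N.t_id n).symm
  · have e := Box.mk_eq_zero (BoxSum.frob_mem_FR
      (BoxSum.IsFrob.right (R := R) hlt (Phi.gr M H m) (Phi.gr N K n)))
    rw [map_sub, sub_eq_zero, gradeInd, gradeRes, Phi.gradeMul_gr, Phi.gradeMul_gr] at e
    exact (Box.elem_smul_mk R _ _ (.ind K H h) _).trans e.symm

variable (β : Box (G := G) R (Phi M) (Phi N) →ₗ[MackeyAlgebra R G] Phi P)

/-- The restriction of a module map to the first summand of the grade `H`. -/
def homTheta (H : Subgroup G) : M.val (orb R H) ⊗[R] N.val (orb R H) →ₗ[R] P.val (orb R H) :=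
  LinearMap.proj (φ := fun H : Subgroup G => P.val (orb R H)) H ∘ₗ β.restrictScalars R ∘ₗ
    Box.mk R (Phi M) (Phi N) ∘ₗ BoxSum.inc R _ _ H ∘ₗ BoxGrade.first R _ _ H ∘ₗ
    TensorProduct.map (Phi.gr M H).toLinearMap (Phi.gr N H).toLinearMap

theorem homTheta_tmul {H : Subgroup G} (m : M.val (orb R H)) (n : N.val (orb R H)) :
    homTheta β H (m ⊗ₜ n) = β (firstTensor M N H m n) H := rfl

theorem inc_homTheta {H : Subgroup G} (m : M.val (orb R H)) (n : N.val (orb R H)) :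
    Phi.inc P H (homTheta β H (m ⊗ₜ n)) = β (firstTensor M N H m n) := by
  conv_rhs => rw [← indEl_self_smul_firstTensor, map_smul, MackeyAlgebra.indEl_self,
    Phi.single_smul, P.ap_id]
  rfl

theorem smul_apply_self {H K : Subgroup G} (f : orb R H ⟶ orb R K)
    (m : M.val (orb R K)) (n : N.val (orb R K)) :
    β (MackeyAlgebra.single H K f • firstTensor M N K m n) H =
      P.ap f (homTheta β K (m ⊗ₜ n)) := by
  rw [map_smul, Phi.single_smul, Phi.inc_same, homTheta_tmul]

theorem t_cmap_homTheta (g : G) {H : Subgroup G} (m : M.val (orb R H)) (n : N.val (orb R H)) :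
    P.t (X := orb R H) (Y := orb R (conj g H)) (cmap g H) (homTheta β H (m ⊗ₜ n)) =
      homTheta β (conj g H) (M.t (X := orb R H) (Y := orb R (conj g H)) (cmap g H) m ⊗ₜ
        N.t (X := orb R H) (Y := orb R (conj g H)) (cmap g H) n) := by
  rw [homTheta_tmul β (H := conj g H), ← conEl_smul_firstTensor]
  exact (smul_apply_self β _ m n).symm

theorem r_proj_homTheta {K H : Subgroup G} (h : K ≤ H) (m : M.val (orb R H))
    (n : N.val (orb R H)) :
    P.r (X := orb R K) (Y := orb R H) (proj h) (homTheta β H (m ⊗ₜ n)) =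
      homTheta β K (M.r (X := orb R K) (Y := orb R H) (proj h) m ⊗ₜ
        N.r (X := orb R K) (Y := orb R H) (proj h) n) := by
  rw [homTheta_tmul β (H := K), ← resEl_smul_firstTensor]
  exact (smul_apply_self β _ m n).symm

theorem t_proj_homTheta_left {K H : Subgroup G} (h : K ≤ H) (m : M.val (orb R K))
    (n : N.val (orb R H)) :
    P.t (X := orb R K) (Y := orb R H) (proj h)
        (homTheta β K (m ⊗ₜ N.r (X := orb R K) (Y := orb R H) (proj h) n)) =
      homTheta β H (M.t (X := orb R K) (Y := orb R H) (proj h) m ⊗ₜ n) := by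
  rw [homTheta_tmul β (H := H), ← indEl_smul_firstTensor_left]
  exact (smul_apply_self β _ _ _).symm

theorem t_proj_homTheta_right {K H : Subgroup G} (h : K ≤ H) (m : M.val (orb R H))
    (n : N.val (orb R K)) :
    P.t (X := orb R K) (Y := orb R H) (proj h)
        (homTheta β K (M.r (X := orb R K) (Y := orb R H) (proj h) m ⊗ₜ n)) =
      homTheta β H (m ⊗ₜ N.t (X := orb R K) (Y := orb R H) (proj h) n) := by
  rw [homTheta_tmul β (H := H), ← indEl_smul_firstTensor_right]
  exact (smul_apply_self β _ _ _).symm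

theorem r_cmap_homTheta (g : G) {H : Subgroup G} (m : M.val (orb R (conj g H)))
    (n : N.val (orb R (conj g H))) :
    P.r (X := orb R H) (Y := orb R (conj g H)) (cmap g H) (homTheta β (conj g H) (m ⊗ₜ n)) =
      homTheta β H (M.r (X := orb R H) (Y := orb R (conj g H)) (cmap g H) m ⊗ₜ
        N.r (X := orb R H) (Y := orb R (conj g H)) (cmap g H) n) := by
  have hb := cmap_bijective g H
  rw [← P.r_t_self (X := orb R H) (Y := orb R (conj g H)) (cmap g H) hb.1
    (homTheta β H _), t_cmap_homTheta, M.t_r_self (X := orb R H) (Y := orb R (conj g H)) _ hb,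
    N.t_r_self (X := orb R H) (Y := orb R (conj g H)) _ hb]

/-- The pairing on transitive `G`-sets given by a module map. -/
def homToOrbitPairing : OrbitPairing M N P where
  θ := homTheta β
  res {K H} f m n := by
    obtain ⟨g, h, rfl⟩ := orbit_hom_factor f
    have hr : ∀ (Q : MackeyFunctor.{u, v, w} R G) (x : Q.val (orb R H)),
        Q.r (X := orb R K) (Y := orb R H) ((proj h).comp (cmap g K)) x =
          Q.r (X := orb R K) (Y := orb R (conj g K)) (cmap g K)
            (Q.r (X := orb R (conj g K)) (Y := orb R H) (proj h) x) :=
      fun Q x => (Q.r_r (X := orb R K) (Y := orb R (conj g K)) (Z := orb R H) _ _ x).symm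
    rw [hr, hr, hr, r_proj_homTheta, r_cmap_homTheta]
  frob_left {K H} f m n := by
    obtain ⟨g, h, rfl⟩ := orbit_hom_factor f
    have hb := cmap_bijective g K
    have ht : ∀ (Q : MackeyFunctor.{u, v, w} R G) (x : Q.val (orb R K)),
        Q.t (X := orb R K) (Y := orb R H) ((proj h).comp (cmap g K)) x =
          Q.t (X := orb R (conj g K)) (Y := orb R H) (proj h)
            (Q.t (X := orb R K) (Y := orb R (conj g K)) (cmap g K) x) :=
      fun Q x => (Q.t_t (X := orb R K) (Y := orb R (conj g K)) (Z := orb R H) _ _ x).symm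
    rw [ht, ht, ← t_proj_homTheta_left, t_cmap_homTheta,
      ← N.r_r (X := orb R K) (Y := orb R (conj g K)) (Z := orb R H),
      N.t_r_self (X := orb R K) (Y := orb R (conj g K)) _ hb]
  frob_right {K H} f m n := by
    obtain ⟨g, h, rfl⟩ := orbit_hom_factor f
    have hb := cmap_bijective g K
    have ht : ∀ (Q : MackeyFunctor.{u, v, w} R G) (x : Q.val (orb R K)),
        Q.t (X := orb R K) (Y := orb R H) ((proj h).comp (cmap g K)) x =
          Q.t (X := orb R (conj g K)) (Y := orb R H) (proj h)
            (Q.t (X := orb R K) (Y := orb R (conj g K)) (cmap g K) x) :=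
      fun Q x => (Q.t_t (X := orb R K) (Y := orb R (conj g K)) (Z := orb R H) _ _ x).symm
    rw [ht, ht, ← t_proj_homTheta_right, t_cmap_homTheta,
      ← M.r_r (X := orb R K) (Y := orb R (conj g K)) (Z := orb R H),
      M.t_r_self (X := orb R K) (Y := orb R (conj g K)) _ hb]

theorem inc_homToOrbitPairing_toDress (H : Subgroup G) (m : M.val (orb R H))
    (n : N.val (orb R H)) :
    Phi.inc P H ((homToOrbitPairing β).toDress.θ (orb R H) (m ⊗ₜ n)) =
      β (firstTensor M N H m n) := by
  rw [OrbitPairing.toDress_orb]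
  exact inc_homTheta β m n

variable (M N P) in
/-- Dress pairings correspond to module maps out of the box product. -/
def dressEquiv :
    DressPairing M N P ≃ (Box (G := G) R (Phi M) (Phi N) →ₗ[MackeyAlgebra R G] Phi P) where
  toFun θ := θ.toHom
  invFun β := (homToOrbitPairing β).toDress
  left_inv θ := DressPairing.ext_orb fun H m n => by
    rw [← Phi.inc_same P H (DressPairing.θ _ _ _), inc_homToOrbitPairing_toDress,
      θ.toHom_firstTensor, Phi.inc_same]
  right_inv β := Box.phi_hom_ext fun H m n => by
    rw [DressPairing.toHom_firstTensor, inc_homToOrbitPairing_toDress]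

end HomToDress

theorem Phi.gradeMap_gr {M M' : MackeyFunctor.{u, v, w} R G} (a : M'.Hom M) (H : Subgroup G)
    (m : M'.val (orb R H)) :
    gradeMap (Phi.map a) H (Phi.gr M' H m) = Phi.gr M H (a.at (orb R H) m) := by
  refine Subtype.ext (funext fun K => ?_)
  change a.at (orb R K) (Phi.inc M' H m K) = Phi.inc M H (a.at (orb R H) m) K
  by_cases h : K = H
  · subst h
    rw [Phi.inc_same, Phi.inc_same]
  · rw [Phi.inc_ne _ h, Phi.inc_ne _ h, map_zero]

theorem Box.map_firstTensor {M M' N N' : MackeyFunctor.{u, v, w} R G} (a : M'.Hom M)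
    (b : N'.Hom N) (H : Subgroup G) (m : M'.val (orb R H)) (n : N'.val (orb R H)) :
    Box.map (Phi.map a) (Phi.map b) (firstTensor M' N' H m n) =
      firstTensor M N H (a.at (orb R H) m) (b.at (orb R H) n) := by
  refine (Box.mapAux_mk (Phi.map a) (Phi.map b) _).trans ?_
  rw [BoxSum.map_inc, BoxGrade.map_first, tensMap, TensorProduct.map_tmul, Phi.gradeMap_gr,
    Phi.gradeMap_gr]
  rfl

theorem Phi.map_inc {P P' : MackeyFunctor.{u, v, w} R G} (c : P.Hom P') (H : Subgroup G)
    (x : P.val (orb R H)) : Phi.map c (Phi.inc P H x) = Phi.inc P' H (c.at (orb R H) x) :=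
  congrArg Subtype.val (Phi.gradeMap_gr c H x)

end MackeyBox

end

theorem mainTheorem2 {G : Type u} [Group G] [Finite G] {R : Type w} [CommRing R] :
    ∃ e : ∀ M N P : MackeyFunctor.{u, v, w} R G,
        DressPairing M N P ≃ (Box (G := G) R (Phi M) (Phi N) →ₗ[MackeyAlgebra R G] Phi P),
      -- the bijection is natural in `M`, `N` and `P`
      (∀ (M M' N N' P P' : MackeyFunctor.{u, v, w} R G) (a : M'.Hom M) (b : N'.Hom N)
        (c : P.Hom P') (θ : DressPairing M N P),
        e M' N' P' (θ.map a b c) =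
          Phi.map c ∘ₗ e M N P θ ∘ₗ Box.map (Phi.map a) (Phi.map b)) ∧
      -- a module map restricts to a pairing on the first summand of each grade
      (∀ (M N P : MackeyFunctor.{u, v, w} R G)
        (β : Box (G := G) R (Phi M) (Phi N) →ₗ[MackeyAlgebra R G] Phi P) (H : Subgroup G)
        (m : M.val (orb R H)) (n : N.val (orb R H)),
        Phi.inc P H (((e M N P).symm β).θ (orb R H) (m ⊗ₜ[R] n)) = β (firstTensor M N H m n)) ∧
      -- a pairing extends to a module map, grade by grade
      (∀ (M N P : MackeyFunctor.{u, v, w} R G) (θ : DressPairing M N P) (H : Subgroup G),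
        (∀ (m : M.val (orb R H)) (n : N.val (orb R H)),
          e M N P θ (firstTensor M N H m n) = Phi.inc P H (θ.θ (orb R H) (m ⊗ₜ[R] n))) ∧
        ∀ (K : Subgroup G) (h : K < H) (x : BoxGrade R (Phi M) (Phi N) K),
          e M N P θ (Box.mk R _ _ (BoxSum.inc R _ _ H (BoxGrade.up R _ _ h x))) =
            (MackeyAlgebra.indEl h.le : MackeyAlgebra R G) •
              e M N P θ (Box.mk R _ _ (BoxSum.inc R _ _ K x))) ∧
      -- module maps out of the box product are the maps out of `A = ⨁ A_H` which commute with
      -- all `R^H_K`, `I^H_K`, `C_{g,H}` and kill the Frobenius reciprocity submodule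
      (∀ M N P : MackeyFunctor.{u, v, w} R G,
        Set.BijOn
          (fun β : Box (G := G) R (Phi M) (Phi N) →ₗ[MackeyAlgebra R G] Phi P =>
            β.restrictScalars R ∘ₗ Box.mk R (Phi M) (Phi N))
          Set.univ
          {f : BoxSum (G := G) R (Phi M) (Phi N) →ₗ[R] Phi P |
            (∀ (s : Gen G) (x : BoxSum (G := G) R (Phi M) (Phi N)),
              f (BoxSum.op R (Phi M) (Phi N) s x) = s.elem R • f x) ∧
            ∀ x ∈ BoxSum.FR (G := G) R (Phi M) (Phi N), f x = 0}) := by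
  refine ⟨dressEquiv, fun M M' N N' P P' a b c θ => Box.phi_hom_ext fun H m n => ?_,
    fun M N P β H m n => inc_homToOrbitPairing_toDress β H m n,
    fun M N P θ H => ⟨θ.toHom_firstTensor H, fun K h x => ?_⟩, fun M N P => Box.bijOn_comp_mk⟩
  · refine ((θ.map a b c).toHom_firstTensor H m n).trans ?_
    rw [LinearMap.comp_apply, LinearMap.comp_apply, Box.map_firstTensor]
    refine Eq.trans ?_ (congrArg (Phi.map c) (θ.toHom_firstTensor H _ _)).symm
    rw [Phi.map_inc]
    rfl
  · rw [← BoxGrade.ind_of_lt, ← BoxSum.op_ind_inc]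
    exact Box.hom_mk_op _ (.ind K H h.le) _
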